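/- Let $D=\{z\in\mathbb{C}:|z|<1\}$, let $s>-1$ be real, and let $dv_s(z)=(s+1)(1-|z|^2)^s\,dv(z)$, where $dv$ is the area measure on $D$ normalized to total mass $1$. Let $A^2_s(D)$ be the Hilbert space of holomorphic functions $f$ on $D$ with $\|f\|_s^2=\int_D|f|^2\,dv_s<\infty$, and for $n\ge 0$ let $$e_n(z)=\sqrt{\frac{\Gamma(s+2+n)}{\Gamma(s+2)\,\Gamma(n+1)}}\;z^n .$$ Let $\varphi$ be an automorphism of $D$ (a holomorphic bijection of $D$ onto itself with holomorphic inverse) and let $p=\varphi^{-1}(0)$. Then the composition operator $C_\varphi f=f\circ\varphi$ is bounded on $A^2_s(D)$, and its adjoint $C_\varphi^*$ satisfies $$\lim_{n\to\infty}\|C_\varphi^*e_n\|_s^2=\frac{1}{(1-|p|^2)^{s+2}}\sum_{k=0}^{\infty}\binom{s+2}{k}^{2}|p|^{2k},$$ where the series converges, and $\binom{c}{0}=1$, $\binom{c}{k}=\dfrac{c(c-1)\cdots(c-k+1)}{k!}$ for $k\ge1$ and real $c$. -/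

import Mathlib

open MeasureTheory Filter Topology
open scoped ENNReal

namespace WeightedBergman

/-- The open unit disk `D` of the complex plane. -/
def disk : Set ℂ := Metric.ball (0 : ℂ) 1

/-- The weighted area measure `dv_s(z) = (s + 1) (1 - |z|²)^s dv(z)` on the disk, where
`dv` is area measure divided by `π`. For `s > -1` this is a probability measure
(and `s + 1 = Γ(s + 2) / Γ(s + 1)`). It is regarded as a measure on `ℂ` carried by `D`. -/
noncomputable def weightedArea (s : ℝ) : Measure ℂ :=
  (volume.restrict disk).withDensity
    (fun z => ENNReal.ofReal ((s + 1) / Real.pi * (1 - ‖z‖ ^ 2) ^ s))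

theorem weightedArea_eq_zero {s : ℝ} (hs : s ≤ -1) : weightedArea s = 0 := by
  have h : (fun z : ℂ => ENNReal.ofReal ((s + 1) / Real.pi * (1 - ‖z‖ ^ 2) ^ s))
      =ᵐ[volume.restrict disk] 0 := by
    filter_upwards [ae_restrict_mem (μ := volume) (s := disk) Metric.isOpen_ball.measurableSet]
      with z hz
    have hz1 : ‖z‖ < 1 := by simpa [disk] using hz
    simp only [Pi.zero_apply, ENNReal.ofReal_eq_zero]
    apply mul_nonpos_of_nonpos_of_nonneg
    · exact div_nonpos_of_nonpos_of_nonneg (by linarith) Real.pi_pos.le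
    · apply Real.rpow_nonneg
      nlinarith [norm_nonneg z]
  rw [weightedArea, withDensity_congr_ae h, withDensity_zero]

theorem radial_integral {s : ℝ} (hs : -1 < s) :
    IntegrableOn (fun r : ℝ => 2 * (s + 1) * r * (1 - r ^ 2) ^ s) (Set.Ioc 0 1) ∧
      ∫ r in (0 : ℝ)..1, 2 * (s + 1) * r * (1 - r ^ 2) ^ s = 1 := by
  have hc : ContinuousOn (fun r : ℝ => -(1 - r ^ 2) ^ (s + 1)) (Set.Icc 0 1) := by
    apply ContinuousOn.neg
    apply ContinuousOn.rpow_const (by fun_prop)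
    intro x _
    right; linarith
  have hd : ∀ r ∈ Set.Ioo (0 : ℝ) 1, HasDerivAt (fun r : ℝ => -(1 - r ^ 2) ^ (s + 1))
      (2 * (s + 1) * r * (1 - r ^ 2) ^ s) r := by
    intro r hr
    have h1 : 0 < 1 - r ^ 2 := by nlinarith [hr.1, hr.2]
    have h2 : HasDerivAt (fun r : ℝ => 1 - r ^ 2) (-(2 * r)) r := by
      simpa using (hasDerivAt_pow 2 r).const_sub 1
    have h3 := (h2.rpow_const (p := s + 1) (Or.inl h1.ne')).neg
    rw [add_sub_cancel_right] at h3
    exact h3.congr_deriv (by ring)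
  have hi : IntegrableOn (fun r : ℝ => 2 * (s + 1) * r * (1 - r ^ 2) ^ s) (Set.Ioc 0 1) := by
    apply intervalIntegral.integrableOn_deriv_of_nonneg hc hd
    intro r hr
    have h1 : 0 < 1 - r ^ 2 := by nlinarith [hr.1, hr.2]
    have := hr.1
    have h4 : 0 < s + 1 := by linarith
    positivity
  refine ⟨hi, ?_⟩
  rw [intervalIntegral.integral_eq_sub_of_hasDerivAt_of_le zero_le_one hc hd
    ((intervalIntegrable_iff_integrableOn_Ioc_of_le zero_le_one).2 hi)]
  have : s + 1 ≠ 0 := by linarith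
  simp [Real.zero_rpow this]

theorem weightedArea_univ {s : ℝ} (hs : -1 < s) : weightedArea s Set.univ = 1 := by
  have hm : MeasurableSet disk := Metric.isOpen_ball.measurableSet
  obtain ⟨hi, hv⟩ := radial_integral hs
  set F : ℝ → ℝ≥0∞ := fun r => ENNReal.ofReal r *
    (Set.Iio (1 : ℝ)).indicator
      (fun r => ENNReal.ofReal ((s + 1) / Real.pi * (1 - r ^ 2) ^ s)) r with hF
  have hFm : Measurable F := by
    apply Measurable.mul (by fun_prop)
    apply Measurable.indicator _ measurableSet_Iio
    fun_prop
  rw [weightedArea, withDensity_apply _ MeasurableSet.univ, Measure.restrict_univ,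
    ← lintegral_indicator hm, ← Complex.lintegral_comp_polarCoord_symm]
  have h1 : ∫⁻ p in polarCoord.target, ENNReal.ofReal p.1 •
      disk.indicator (fun z : ℂ => ENNReal.ofReal ((s + 1) / Real.pi * (1 - ‖z‖ ^ 2) ^ s))
        (Complex.polarCoord.symm p) = ∫⁻ p in polarCoord.target, F p.1 := by
    refine setLIntegral_congr_fun polarCoord.open_target.measurableSet fun p hp => ?_
    have hp0 : 0 < p.1 := hp.1
    have hn : ‖Complex.polarCoord.symm p‖ = p.1 := by
      rw [Complex.norm_polarCoord_symm, abs_of_pos hp0]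
    simp only [hF, smul_eq_mul, Set.indicator, disk, Metric.mem_ball, dist_zero_right, hn,
      Set.mem_Iio]
  rw [h1, show polarCoord.target = Set.Ioi (0 : ℝ) ×ˢ Set.Ioo (-Real.pi) Real.pi from rfl,
    Measure.volume_eq_prod, ← Measure.prod_restrict,
    lintegral_prod (fun p : ℝ × ℝ => F p.1) (hFm.comp measurable_fst).aemeasurable]
  simp only [lintegral_const, Measure.restrict_apply MeasurableSet.univ, Set.univ_inter,
    Real.volume_Ioo]
  have h2 : ∫⁻ r in Set.Ioi (0 : ℝ), F r * ENNReal.ofReal (Real.pi - -Real.pi)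
      = ∫⁻ r in Set.Ioo (0 : ℝ) 1, ENNReal.ofReal (2 * (s + 1) * r * (1 - r ^ 2) ^ s) := by
    rw [← Set.Ioi_inter_Iio, Set.inter_comm, ← Measure.restrict_restrict measurableSet_Iio,
      ← lintegral_indicator (μ := volume.restrict (Set.Ioi (0 : ℝ))) measurableSet_Iio]
    refine setLIntegral_congr_fun measurableSet_Ioi fun r hr => ?_
    have hr0 : 0 < r := hr
    by_cases h : r < 1
    · have hb : 0 < 1 - r ^ 2 := by nlinarith
      have hs1 : 0 < s + 1 := by linarith
      have hpi := Real.pi_pos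
      simp only [hF, Set.indicator, Set.mem_Iio, h, if_true]
      rw [← ENNReal.ofReal_mul hr0.le, ← ENNReal.ofReal_mul (by positivity)]
      congr 1
      field_simp
      ring
    · simp [hF, Set.indicator, h]
  rw [h2, ← ofReal_integral_eq_lintegral_ofReal]
  · rw [← integral_Ioc_eq_integral_Ioo, ← intervalIntegral.integral_of_le zero_le_one, hv,
      ENNReal.ofReal_one]
  · exact hi.mono_set Set.Ioo_subset_Ioc_self
  · filter_upwards [ae_restrict_mem measurableSet_Ioo] with r hr
    have hb : 0 < 1 - r ^ 2 := by nlinarith [hr.1, hr.2]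
    have hs1 : 0 < s + 1 := by linarith
    have := hr.1
    simp only [Pi.zero_apply]
    positivity

instance (s : ℝ) : IsFiniteMeasure (weightedArea s) := by
  constructor
  rcases le_or_gt s (-1) with h | h
  · simp [weightedArea_eq_zero h]
  · simp [weightedArea_univ h]

theorem ae_mem_disk (s : ℝ) : ∀ᵐ z ∂(weightedArea s), z ∈ disk :=
  (withDensity_absolutelyContinuous _ _).ae_le
    (ae_restrict_mem (μ := volume) (s := disk) Metric.isOpen_ball.measurableSet)

/-- `g`, a function on the disk (its values off the disk are irrelevant), is holomorphic on the
disk and represents the class `f ∈ L²(D, dv_s)`. -/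
def IsHolomorphicRep {s : ℝ} (f : Lp ℂ 2 (weightedArea s)) (g : ℂ → ℂ) : Prop :=
  DifferentiableOn ℂ g disk ∧ (f : ℂ → ℂ) =ᵐ[weightedArea s] g

/-- The weighted Bergman space `A²_s(D)`: the holomorphic functions on the disk that are square
integrable for `dv_s`, as a subspace of the Hilbert space `L²(D, dv_s)`. -/
noncomputable def bergmanSpace (s : ℝ) : Submodule ℂ (Lp ℂ 2 (weightedArea s)) where
  carrier := {f | ∃ g : ℂ → ℂ, IsHolomorphicRep f g}
  zero_mem' := ⟨0, differentiableOn_const 0, Lp.coeFn_zero _ _ _⟩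
  add_mem' := by
    rintro f₁ f₂ ⟨g₁, h₁, e₁⟩ ⟨g₂, h₂, e₂⟩
    exact ⟨g₁ + g₂, h₁.add h₂, (Lp.coeFn_add f₁ f₂).trans (e₁.add e₂)⟩
  smul_mem' := by
    rintro c f ⟨g, h, e⟩
    exact ⟨c • g, h.const_smul c, (Lp.coeFn_smul c f).trans (e.const_smul c)⟩

/-- Area mean value property. -/
theorem area_mean_value {g : ℂ → ℂ} {z : ℂ} {R : ℝ} (hR : 0 < R)
    (hg : DifferentiableOn ℂ g (Metric.closedBall z R)) :
    ∫ w in Metric.ball z R, g w = ((Real.pi * R ^ 2 : ℝ) : ℂ) * g z := by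
  have hint : IntegrableOn g (Metric.ball z R) :=
    (hg.continuousOn.integrableOn_compact (isCompact_closedBall z R)).mono_set
      Metric.ball_subset_closedBall
  set G : ℂ → ℂ := (Metric.ball (0 : ℂ) R).indicator (fun w => g (z + w)) with hG
  have h0 : ∫ w in Metric.ball z R, g w = ∫ w, G w := by
    rw [← integral_indicator Metric.isOpen_ball.measurableSet,
      ← integral_add_left_eq_self (μ := (volume : Measure ℂ)) _ z]
    refine integral_congr_ae (ae_of_all _ fun w => ?_)
    simp [hG, Set.indicator]
  have hsymm : ∀ r θ : ℝ, z + Complex.polarCoord.symm (r, θ) = circleMap z r θ := by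
    intro r θ
    rw [Complex.polarCoord_symm_apply, circleMap, Complex.exp_mul_I]
    simp
  have hmv : ∀ r ∈ Set.Ioo (0 : ℝ) R, ∫ θ in Set.Ioo (-Real.pi) Real.pi,
      r • g (circleMap z r θ) = ((2 * Real.pi * r : ℝ) : ℂ) * g z := by
    intro r hr
    have hd : DiffContOnCl ℂ g (Metric.ball z |r|) := by
      rw [abs_of_pos hr.1]
      apply DifferentiableOn.diffContOnCl
      refine hg.mono (Metric.closure_ball_subset_closedBall.trans ?_)
      exact Metric.closedBall_subset_closedBall hr.2.le
    have h1 := hd.circleAverage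
    rw [Real.circleAverage_eq_integral_add (-Real.pi),
      intervalIntegral.integral_comp_add_right (fun θ => g (circleMap z r θ)),
      show (0 : ℝ) + -Real.pi = -Real.pi by ring,
      show 2 * Real.pi + -Real.pi = Real.pi by ring,
      intervalIntegral.integral_of_le (by linarith [Real.pi_pos]),
      integral_Ioc_eq_integral_Ioo, inv_smul_eq_iff₀ (by positivity)] at h1
    rw [integral_smul, h1, smul_smul, Complex.real_smul]
    push_cast
    ring
  have hmem : ∀ r θ : ℝ, r ∈ Set.Icc (0 : ℝ) R → circleMap z r θ ∈ Metric.closedBall z R := by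
    intro r θ hr
    exact Metric.closedBall_subset_closedBall hr.2 (circleMap_mem_closedBall z hr.1 θ)
  have hI : IntegrableOn (fun p : ℝ × ℝ => p.1 • g (circleMap z p.1 p.2))
      (Set.Ioo (0 : ℝ) R ×ˢ Set.Ioo (-Real.pi) Real.pi) := by
    have hcm : Continuous (fun p : ℝ × ℝ => circleMap z p.1 p.2) := by
      unfold circleMap; fun_prop
    refine (ContinuousOn.integrableOn_compact
      (isCompact_Icc.prod (isCompact_Icc (a := -Real.pi) (b := Real.pi)))
      (continuous_fst.continuousOn.smul
        (hg.continuousOn.comp hcm.continuousOn ?_))).mono_set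
      (Set.prod_mono Set.Ioo_subset_Icc_self Set.Ioo_subset_Icc_self)
    exact fun p hp => hmem _ _ hp.1
  have h2 : ∫ w, G w = ∫ p in Set.Ioo (0 : ℝ) R ×ˢ Set.Ioo (-Real.pi) Real.pi,
      p.1 • g (circleMap z p.1 p.2) := by
    have hms : MeasurableSet (Set.Ioo (0 : ℝ) R ×ˢ Set.Ioo (-Real.pi) Real.pi) :=
      measurableSet_Ioo.prod measurableSet_Ioo
    rw [← Complex.integral_comp_polarCoord_symm,
      setIntegral_eq_of_subset_of_forall_sdiff_eq_zero polarCoord.open_target.measurableSet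
        (s := Set.Ioo (0 : ℝ) R ×ˢ Set.Ioo (-Real.pi) Real.pi)]
    · refine setIntegral_congr_fun hms fun p hp => ?_
      have hn : ‖Complex.polarCoord.symm p‖ = p.1 := by
        rw [Complex.norm_polarCoord_symm, abs_of_pos hp.1.1]
      have hin : Complex.polarCoord.symm p ∈ Metric.ball (0 : ℂ) R := by
        rw [mem_ball_zero_iff, hn]; exact hp.1.2
      simp only [hG, Set.indicator_of_mem hin]
      rw [hsymm p.1 p.2]
    · exact fun p hp => ⟨hp.1.1, hp.2⟩
    · intro p hp
      have hp0 : (0 : ℝ) < p.1 := hp.1.1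
      have hn : ‖Complex.polarCoord.symm p‖ = p.1 := by
        rw [Complex.norm_polarCoord_symm, abs_of_pos hp0]
      have hin : Complex.polarCoord.symm p ∉ Metric.ball (0 : ℂ) R := by
        rw [mem_ball_zero_iff, hn]
        exact fun h => hp.2 ⟨⟨hp0, h⟩, hp.1.2⟩
      simp only [hG, Set.indicator_of_notMem hin, smul_zero]
  rw [h0, h2, Measure.volume_eq_prod, setIntegral_prod _ hI,
    setIntegral_congr_fun measurableSet_Ioo hmv, integral_mul_const, integral_complex_ofReal,
    ← integral_Ioc_eq_integral_Ioo, ← intervalIntegral.integral_of_le hR.le,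
    intervalIntegral.integral_const_mul, integral_id]
  congr 2
  ring

theorem enorm_le_eLpNorm {s : ℝ} (hs : -1 < s) {ρ : ℝ} (hρ0 : 0 < ρ) (hρ : ρ < 1) :
    ∃ K : ℝ≥0∞, K ≠ ∞ ∧ ∀ g : ℂ → ℂ, DifferentiableOn ℂ g disk →
      ∀ z ∈ Metric.closedBall (0 : ℂ) ρ, ‖g z‖ₑ ≤ K * eLpNorm g 2 (weightedArea s) := by
  set R : ℝ := (1 - ρ) / 2 with hRdef
  have hR : 0 < R := by simp only [hRdef]; linarith
  set ρ' : ℝ := (1 + ρ) / 2 with hρ'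
  have hρ'1 : ρ' < 1 := by simp only [hρ']; linarith
  have hρ'0 : 0 < ρ' := by simp only [hρ']; linarith
  have hs1 : 0 < s + 1 := by linarith
  -- a positive lower bound for the weight on the smaller disk
  obtain ⟨m, hm0, hm⟩ : ∃ m : ℝ, 0 < m ∧ ∀ w ∈ Metric.closedBall (0 : ℂ) ρ',
      m ≤ (s + 1) / Real.pi * (1 - ‖w‖ ^ 2) ^ s := by
    have hpos : ∀ w ∈ Metric.closedBall (0 : ℂ) ρ', 0 < 1 - ‖w‖ ^ 2 := by
      intro w hw
      have : ‖w‖ ≤ ρ' := by simpa using hw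
      nlinarith [norm_nonneg w]
    have hc : ContinuousOn (fun w : ℂ => (s + 1) / Real.pi * (1 - ‖w‖ ^ 2) ^ s)
        (Metric.closedBall (0 : ℂ) ρ') := by
      refine continuousOn_const.mul (ContinuousOn.rpow_const (by fun_prop) ?_)
      exact fun w hw => Or.inl (hpos w hw).ne'
    obtain ⟨w₀, hw₀, hmin⟩ := (isCompact_closedBall (0 : ℂ) ρ').exists_isMinOn
      ⟨0, by simp [hρ'0.le]⟩ hc
    refine ⟨_, ?_, fun w hw => hmin hw⟩
    have := hpos w₀ hw₀
    have hpi := Real.pi_pos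
    positivity
  set A : ℝ := Real.pi * R ^ 2 with hA
  have hA0 : 0 < A := by have := Real.pi_pos; positivity
  refine ⟨ENNReal.ofReal (A * m)⁻¹, ENNReal.ofReal_ne_top, fun g hg z hz => ?_⟩
  have hz' : ‖z‖ ≤ ρ := by simpa using hz
  have hsub' : Metric.closedBall z R ⊆ Metric.closedBall (0 : ℂ) ρ' := by
    apply Metric.closedBall_subset_closedBall'
    simp only [dist_zero_right, hRdef, hρ']
    linarith
  have hsub : Metric.closedBall z R ⊆ disk :=
    hsub'.trans (Metric.closedBall_subset_ball hρ'1)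
  have hmean := area_mean_value hR (hg.mono hsub)
  have hmeas : AEMeasurable (fun w => ‖g w‖ₑ) (volume.restrict disk) :=
    (hg.continuousOn.aestronglyMeasurable Metric.isOpen_ball.measurableSet).enorm
  have hgm : AEStronglyMeasurable g (weightedArea s) :=
    (hg.continuousOn.aestronglyMeasurable Metric.isOpen_ball.measurableSet).mono_ac
      (withDensity_absolutelyContinuous _ _)
  have h1 : ENNReal.ofReal A * ‖g z‖ₑ ≤ ∫⁻ w in Metric.ball z R, ‖g w‖ₑ := by
    have h := enorm_integral_le_lintegral_enorm (μ := volume.restrict (Metric.ball z R)) g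
    rw [hmean, enorm_mul] at h
    convert h using 2
    rw [← ofReal_norm, Complex.norm_real, Real.norm_of_nonneg hA0.le]
  have h2 : ENNReal.ofReal m * ∫⁻ w in Metric.ball z R, ‖g w‖ₑ ≤
      ∫⁻ w, ‖g w‖ₑ ∂(weightedArea s) := by
    rw [weightedArea, lintegral_withDensity_eq_lintegral_mul₀ (by fun_prop) hmeas,
      ← lintegral_const_mul' _ _ ENNReal.ofReal_ne_top]
    calc ∫⁻ w in Metric.ball z R, ENNReal.ofReal m * ‖g w‖ₑ
        ≤ ∫⁻ w in Metric.ball z R, ENNReal.ofReal ((s + 1) / Real.pi * (1 - ‖w‖ ^ 2) ^ s)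
            * ‖g w‖ₑ := by
          refine setLIntegral_mono' Metric.isOpen_ball.measurableSet fun w hw => ?_
          gcongr
          exact hm w (hsub' (Metric.ball_subset_closedBall hw))
      _ ≤ _ := lintegral_mono_set (Metric.ball_subset_closedBall.trans hsub)
  have h3 : ∫⁻ w, ‖g w‖ₑ ∂(weightedArea s) ≤ eLpNorm g 2 (weightedArea s) := by
    rw [← eLpNorm_one_eq_lintegral_enorm]
    have : IsProbabilityMeasure (weightedArea s) := ⟨weightedArea_univ hs⟩
    exact eLpNorm_le_eLpNorm_of_exponent_le one_le_two hgm
  have h4 : ENNReal.ofReal (A * m) * ‖g z‖ₑ ≤ eLpNorm g 2 (weightedArea s) := by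
    rw [ENNReal.ofReal_mul hA0.le, mul_comm (ENNReal.ofReal A), mul_assoc]
    exact (mul_le_mul_right h1 _).trans (h2.trans h3)
  have hAm : 0 < A * m := by positivity
  rw [ENNReal.ofReal_inv_of_pos hAm, mul_comm, ← div_eq_mul_inv,
    ENNReal.le_div_iff_mul_le (Or.inl (by simpa using hAm)) (Or.inl ENNReal.ofReal_ne_top),
    mul_comm]
  exact h4

theorem isClosed_bergmanSpace (s : ℝ) :
    IsClosed (bergmanSpace s : Set (Lp ℂ 2 (weightedArea s))) := by
  rcases le_or_gt s (-1) with hs | hs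
  · convert isClosed_univ
    refine Set.eq_univ_of_forall fun f => ⟨0, differentiableOn_const 0, ?_⟩
    simp [Filter.EventuallyEq, weightedArea_eq_zero hs]
  refine IsSeqClosed.isClosed fun f f₀ hf hlim => ?_
  choose g hg using hf
  have hcau := hlim.cauchySeq
  have hball : ∀ ρ : ℝ, 0 < ρ → ρ < 1 →
      UniformCauchySeqOn g atTop (Metric.closedBall (0 : ℂ) ρ) := by
    intro ρ hρ0 hρ1
    obtain ⟨K, hK, hKg⟩ := enorm_le_eLpNorm hs hρ0 hρ1
    rw [Metric.uniformCauchySeqOn_iff]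
    intro ε hε
    obtain ⟨N, hN⟩ := Metric.cauchySeq_iff.1 hcau (ε / (K.toReal + 1)) (by positivity)
    refine ⟨N, fun a ha b hb z hz => ?_⟩
    have h1 := hKg (g a - g b) ((hg a).1.sub (hg b).1) z hz
    have h2 : eLpNorm (g a - g b) 2 (weightedArea s) = ENNReal.ofReal (dist (f a) (f b)) := by
      rw [dist_eq_norm, Lp.norm_def, ENNReal.ofReal_toReal (Lp.eLpNorm_ne_top _)]
      exact eLpNorm_congr_ae (((hg a).2.sub (hg b).2).symm.trans (Lp.coeFn_sub _ _).symm)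
    rw [h2, ← ENNReal.ofReal_toReal hK, ← ENNReal.ofReal_mul ENNReal.toReal_nonneg,
      ← ofReal_norm, ENNReal.ofReal_le_ofReal_iff (by positivity)] at h1
    rw [dist_eq_norm]
    have h3 := hN a ha b hb
    rw [lt_div_iff₀ (by positivity)] at h3
    have h4 : ‖g a z - g b z‖ ≤ K.toReal * dist (f a) (f b) := h1
    nlinarith [dist_nonneg (x := f a) (y := f b)]
  have hdisk : ∀ z ∈ disk, ∃ ρ : ℝ, 0 < ρ ∧ ρ < 1 ∧ z ∈ Metric.ball (0 : ℂ) ρ := by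
    intro z hz
    have hz1 : ‖z‖ < 1 := by simpa [disk] using hz
    refine ⟨(1 + ‖z‖) / 2, by positivity, by linarith, ?_⟩
    rw [mem_ball_zero_iff]; linarith
  have hex : ∀ z : ℂ, ∃ l : ℂ, z ∈ disk → Tendsto (fun k => g k z) atTop (𝓝 l) := by
    intro z
    by_cases hz : z ∈ disk
    · obtain ⟨ρ, h0, h1, hzρ⟩ := hdisk z hz
      obtain ⟨l, hl⟩ := cauchySeq_tendsto_of_complete
        ((hball ρ h0 h1).cauchySeq (Metric.ball_subset_closedBall hzρ))
      exact ⟨l, fun _ => hl⟩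
    · exact ⟨0, fun h => absurd h hz⟩
  choose G hG using hex
  have hloc : TendstoLocallyUniformlyOn g G atTop disk := by
    rw [tendstoLocallyUniformlyOn_iff_forall_tendsto]
    intro z hz
    obtain ⟨ρ, h0, h1, hzρ⟩ := hdisk z hz
    have hu := (hball ρ h0 h1).tendstoUniformlyOn_of_tendsto (f := G)
      (fun w hw => hG w (Metric.closedBall_subset_ball h1 hw))
    rw [tendstoUniformlyOn_iff_tendsto] at hu
    refine hu.mono_left (Filter.prod_mono le_rfl ?_)
    rw [Filter.le_principal_iff]
    exact mem_nhdsWithin_of_mem_nhds (mem_of_superset (Metric.isOpen_ball.mem_nhds hzρ)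
      Metric.ball_subset_closedBall)
  have hGd : DifferentiableOn ℂ G disk :=
    hloc.differentiableOn (Eventually.of_forall fun k => (hg k).1) Metric.isOpen_ball
  refine ⟨G, hGd, ?_⟩
  obtain ⟨ns, hns, hae⟩ := (tendstoInMeasure_of_tendsto_Lp hlim).exists_seq_tendsto_ae
  have hall : ∀ᵐ z ∂(weightedArea s), ∀ k, (f k : ℂ → ℂ) z = g k z :=
    ae_all_iff.2 fun k => (hg k).2
  filter_upwards [hae, hall, ae_mem_disk s] with z h1 h2 h3
  refine tendsto_nhds_unique h1 (((hG z h3).comp hns.tendsto_atTop).congr fun k => ?_)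
  exact (h2 (ns k)).symm

instance (s : ℝ) : CompleteSpace (bergmanSpace s) :=
  (isClosed_bergmanSpace s).completeSpace_coe

theorem memLp_monomial (s : ℝ) (c : ℂ) (n : ℕ) :
    MemLp (fun z : ℂ => c * z ^ n) 2 (weightedArea s) := by
  refine MemLp.of_bound (by fun_prop : Continuous _).aestronglyMeasurable ‖c‖ ?_
  filter_upwards [ae_mem_disk s] with z hz
  have hz1 : ‖z‖ < 1 := by simpa [disk] using hz
  rw [norm_mul, norm_pow]
  exact mul_le_of_le_one_right (norm_nonneg _) (pow_le_one₀ (norm_nonneg _) hz1.le)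

/-- The normalized monomial `e_n(z) = √(Γ(s+2+n) / (Γ(s+2) Γ(n+1))) zⁿ` in `A²_s(D)`. -/
noncomputable def normalizedMonomial (s : ℝ) (n : ℕ) : bergmanSpace s :=
  ⟨(memLp_monomial s
      (√(Real.Gamma (s + 2 + n) / (Real.Gamma (s + 2) * Real.Gamma (n + 1))) : ℝ) n).toLp,
    _, by fun_prop, MemLp.coeFn_toLp _⟩

/-- `φ` is an automorphism of the disk: a holomorphic self-map of the disk with a holomorphic
inverse. (Values of `φ` off the disk are irrelevant.) -/
def IsDiskAutomorphism (φ : ℂ → ℂ) : Prop :=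
  DifferentiableOn ℂ φ disk ∧ Set.MapsTo φ disk disk ∧
    ∃ ψ : ℂ → ℂ, DifferentiableOn ℂ ψ disk ∧ Set.MapsTo ψ disk disk ∧
      Set.LeftInvOn ψ φ disk ∧ Set.RightInvOn ψ φ disk

/-- The bounded operator `C` on `A²_s(D)` is the composition operator `f ↦ f ∘ φ`. -/
def IsCompositionOperator {s : ℝ} (C : bergmanSpace s →L[ℂ] bergmanSpace s) (φ : ℂ → ℂ) : Prop :=
  ∀ (f : bergmanSpace s) (g : ℂ → ℂ),
    IsHolomorphicRep (f : Lp ℂ 2 (weightedArea s)) g →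
      IsHolomorphicRep (C f : Lp ℂ 2 (weightedArea s)) (g ∘ φ)

end WeightedBergman

namespace WeightedBergman

/-! The operator is a multiplication after a unitary. With h(z) = (1 - p̄z)^(s+2) / (1 -
|p|²)^((s+2)/2) (`multiplierSymbol`), the Jacobian of φ gives |h|⁻² = (1 - |φ|²)^s |φ'|² / (1 -
|z|²)^s. Hence U f = h⁻¹ · (f ∘ φ) preserves the norm of A²_s(D), and it is onto because φ is
invertible (`IsDiskAutomorphism.exists_unitary`). Since h is bounded and holomorphic, multiplication
by it is a bounded operator M. Then C_φ = M U is bounded, and C_φ* = U* M* with U* isometric, so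
‖C_φ* e_n‖ = ‖M* e_n‖.

Write h = ∑ b_k z^k, and let w_n be the square of the normalizing factor of e_n. As ⟨e_n, f⟩ is the
n-th Taylor coefficient of f divided by √w_n, the Cauchy product for h f gives M* e_n = ∑_{m ≤ n}
conj(b_{n-m}) √(w_m / w_n) e_m. Therefore ‖M* e_n‖² = ∑_{k ≤ n} |b_k|² w_{n-k} / w_n
(`norm_adjoint_mul_normalizedMonomial_sq`). The ratios are at most 1 and tend to 1 for fixed k, so
dominated convergence yields ∑ |b_k|² (`tendsto_sum_mul_monomialWeight_div`), which the binomial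
series makes explicit. -/

/-! ### Polar coordinates for the weighted measure -/

/-- In polar coordinates, integration against `dv_s` is an iterated integral. -/
theorem integral_weightedArea_polar {s : ℝ} (hs : -1 < s) {F : ℂ → ℂ}
    (hc : ContinuousOn F disk) (hF : Integrable F (weightedArea s)) :
    ∫ z, F z ∂(weightedArea s) = ∫ r in Set.Ioo (0 : ℝ) 1, ∫ θ in Set.Ioo (-Real.pi) Real.pi,
      (r * ((s + 1) / Real.pi * (1 - r ^ 2) ^ s)) • F (circleMap 0 r θ) := by
  have hm : MeasurableSet disk := Metric.isOpen_ball.measurableSet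
  have hwm : Measurable (fun z : ℂ => ENNReal.ofReal ((s + 1) / Real.pi * (1 - ‖z‖ ^ 2) ^ s)) := by
    fun_prop
  have hw0 : ∀ r : ℝ, 0 ≤ r → r < 1 → 0 ≤ (s + 1) / Real.pi * (1 - r ^ 2) ^ s := by
    intro r h0 h1
    have : 0 < 1 - r ^ 2 := by nlinarith
    have : 0 < s + 1 := by linarith
    have := Real.pi_pos
    positivity
  set G : ℂ → ℂ := disk.indicator
    (fun z => (ENNReal.ofReal ((s + 1) / Real.pi * (1 - ‖z‖ ^ 2) ^ s)).toReal • F z) with hG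
  have hGint : Integrable G := by
    rw [hG, integrable_indicator_iff hm, IntegrableOn,
      ← integrable_withDensity_iff_integrable_smul' hwm (ae_of_all _ fun _ => ENNReal.ofReal_lt_top)]
    exact hF
  have h0 : ∫ z, F z ∂(weightedArea s) = ∫ z, G z := by
    rw [hG, integral_indicator hm, weightedArea,
      integral_withDensity_eq_integral_toReal_smul hwm
        (ae_of_all _ fun _ => ENNReal.ofReal_lt_top)]
  have hsymm : ∀ p : ℝ × ℝ, Complex.polarCoord.symm p = circleMap 0 p.1 p.2 := by
    intro p
    rw [Complex.polarCoord_symm_apply, circleMap, Complex.exp_mul_I]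
    simp
  have hGv : ∀ p ∈ Set.Ioo (0 : ℝ) 1 ×ˢ Set.Ioo (-Real.pi) Real.pi,
      p.1 • G (Complex.polarCoord.symm p) =
        (p.1 * ((s + 1) / Real.pi * (1 - p.1 ^ 2) ^ s)) • F (circleMap 0 p.1 p.2) := by
    intro p hp
    have hn : ‖Complex.polarCoord.symm p‖ = p.1 := by
      rw [Complex.norm_polarCoord_symm, abs_of_pos hp.1.1]
    have hin : Complex.polarCoord.symm p ∈ disk := by
      rw [disk, mem_ball_zero_iff, hn]; exact hp.1.2
    simp only [hG, Set.indicator_of_mem hin, hn]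
    rw [ENNReal.toReal_ofReal (hw0 _ hp.1.1.le hp.1.2), smul_smul, hsymm]
  have hms : MeasurableSet (Set.Ioo (0 : ℝ) 1 ×ˢ Set.Ioo (-Real.pi) Real.pi) :=
    measurableSet_Ioo.prod measurableSet_Ioo
  have hsub : Set.Ioo (0 : ℝ) 1 ×ˢ Set.Ioo (-Real.pi) Real.pi ⊆ polarCoord.target :=
    fun p hp => ⟨hp.1.1, hp.2⟩
  have hI : IntegrableOn (fun p : ℝ × ℝ =>
      (p.1 * ((s + 1) / Real.pi * (1 - p.1 ^ 2) ^ s)) • F (circleMap 0 p.1 p.2))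
      (Set.Ioo (0 : ℝ) 1 ×ˢ Set.Ioo (-Real.pi) Real.pi) := by
    refine ⟨ContinuousOn.aestronglyMeasurable ?_ hms, ?_⟩
    · have hcm : Continuous (fun p : ℝ × ℝ => circleMap 0 p.1 p.2) := by
        unfold circleMap; fun_prop
      refine ContinuousOn.smul (f := fun p : ℝ × ℝ =>
        p.1 * ((s + 1) / Real.pi * (1 - p.1 ^ 2) ^ s)) ?_ (hc.comp hcm.continuousOn ?_)
      · refine continuousOn_fst.mul (continuousOn_const.mul
          (ContinuousOn.rpow_const (by fun_prop) ?_))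
        intro p hp
        left
        nlinarith [hp.1.1, hp.1.2]
      · intro p hp
        rw [disk, mem_ball_zero_iff, norm_circleMap_zero, abs_of_pos hp.1.1]
        exact hp.1.2
    -- F may be unbounded near the unit circle, so the integrability that Fubini requires comes from
    -- that of G, through the polar formula for ‖G‖.
    · have h1 : ∫⁻ p in polarCoord.target, ENNReal.ofReal p.1 • ‖G (Complex.polarCoord.symm p)‖ₑ
          < ∞ := by
        rw [Complex.lintegral_comp_polarCoord_symm (fun z => ‖G z‖ₑ)]
        exact hGint.2
      refine lt_of_le_of_lt ?_ h1
      refine le_trans (setLIntegral_mono' hms fun p hp => ?_) (lintegral_mono_set hsub)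
      simp only
      rw [← hGv p hp, enorm_smul, smul_eq_mul, Real.enorm_of_nonneg hp.1.1.le]
  rw [h0, ← Complex.integral_comp_polarCoord_symm,
    setIntegral_eq_of_subset_of_forall_sdiff_eq_zero polarCoord.open_target.measurableSet hsub,
    setIntegral_congr_fun hms hGv, Measure.volume_eq_prod, setIntegral_prod _ hI]
  intro p hp
  have hp0 : (0 : ℝ) < p.1 := hp.1.1
  have hn : ‖Complex.polarCoord.symm p‖ = p.1 := by
    rw [Complex.norm_polarCoord_symm, abs_of_pos hp0]
  have hin : Complex.polarCoord.symm p ∉ disk := by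
    rw [disk, mem_ball_zero_iff, hn]
    exact fun h => hp.2 ⟨⟨hp0, h⟩, hp.1.2⟩
  simp only [hG, Set.indicator_of_notMem hin, smul_zero]

/-! ### Normalizing factors and radial moments -/

/-- The square of the normalizing factor of the `n`-th monomial. -/
noncomputable def monomialWeight (s : ℝ) (n : ℕ) : ℝ :=
  Real.Gamma (s + 2 + n) / (Real.Gamma (s + 2) * Real.Gamma (n + 1))

theorem monomialWeight_zero {s : ℝ} (hs : -1 < s) : monomialWeight s 0 = 1 := by
  have : Real.Gamma (s + 2) ≠ 0 := (Real.Gamma_pos_of_pos (by linarith)).ne'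
  simp [monomialWeight, this]

/-- From Γ(x+1) = xΓ(x). The monotonicity of the weights, the limit of their ratios and the radial
moments all rest on this recursion. -/
theorem monomialWeight_succ {s : ℝ} (hs : -1 < s) (n : ℕ) :
    monomialWeight s (n + 1) = (s + 2 + n) / (n + 1) * monomialWeight s n := by
  have hn : (0 : ℝ) ≤ n := n.cast_nonneg
  have h1 : s + 2 + n ≠ 0 := by linarith
  have h2 : (n : ℝ) + 1 ≠ 0 := by positivity
  have h3 : Real.Gamma (s + 2) ≠ 0 := (Real.Gamma_pos_of_pos (by linarith)).ne'
  have h4 : Real.Gamma (n + 1) ≠ 0 := (Real.Gamma_pos_of_pos (by positivity)).ne'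
  rw [monomialWeight, monomialWeight, Nat.cast_succ, ← add_assoc, Real.Gamma_add_one h1,
    Real.Gamma_add_one h2]
  field_simp

theorem monomialWeight_pos {s : ℝ} (hs : -1 < s) (n : ℕ) : 0 < monomialWeight s n := by
  have hn : (0 : ℝ) ≤ n := n.cast_nonneg
  exact div_pos (Real.Gamma_pos_of_pos (by linarith)) (mul_pos
    (Real.Gamma_pos_of_pos (by linarith)) (Real.Gamma_pos_of_pos (by linarith)))

/-- The ratio (s+2+n)/(n+1) is at least 1 because s > -1. This provides the domination in the final
limit. -/
theorem monomialWeight_le_succ {s : ℝ} (hs : -1 < s) (n : ℕ) :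
    monomialWeight s n ≤ monomialWeight s (n + 1) := by
  rw [monomialWeight_succ hs]
  refine le_mul_of_one_le_left (monomialWeight_pos hs n).le ?_
  have hn : (0 : ℝ) ≤ n := n.cast_nonneg
  rw [one_le_div (by linarith)]
  linarith

theorem monotone_monomialWeight {s : ℝ} (hs : -1 < s) : Monotone (monomialWeight s) :=
  monotone_nat_of_le_succ (monomialWeight_le_succ hs)

/-- The quotient telescopes into k factors (n+j+1)/(n+j+s+2), each tending to 1. -/
theorem tendsto_monomialWeight_div_add {s : ℝ} (hs : -1 < s) (k : ℕ) :
    Tendsto (fun n : ℕ => monomialWeight s n / monomialWeight s (n + k)) atTop (𝓝 1) := by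
  induction k with
  | zero =>
    refine tendsto_const_nhds.congr fun n => ?_
    rw [add_zero, div_self (monomialWeight_pos hs n).ne']
  | succ k ih =>
    have h1 : Tendsto (fun n : ℕ => ((n : ℝ) + 1) / (n + (s + 2))) atTop (𝓝 1) := by
      simpa [add_comm] using tendsto_add_mul_div_add_mul_atTop_nhds (𝕜 := ℝ) 1 (s + 2) 1 (d := 1) one_ne_zero
    have h2 := ih.mul (h1.comp (tendsto_add_atTop_nat k))
    rw [mul_one] at h2
    refine h2.congr fun n => ?_
    have := (monomialWeight_pos hs (n + k)).ne'
    have hn : (0 : ℝ) ≤ (n + k : ℕ) := Nat.cast_nonneg _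
    have h3 : s + 2 + (n + k : ℕ) ≠ 0 := by linarith
    rw [← add_assoc n k 1, monomialWeight_succ hs]
    simp only [Function.comp_apply]
    rw [add_comm ((n + k : ℕ) : ℝ) (s + 2)]
    field_simp

/-- The moments of the radial density. -/
theorem radial_moment {s : ℝ} (hs : -1 < s) (n : ℕ) :
    ∫ r in (0 : ℝ)..1, 2 * (s + 1) * r * (1 - r ^ 2) ^ s * r ^ (2 * n) =
      (monomialWeight s n)⁻¹ := by
  have hint : ∀ k : ℕ, IntervalIntegrable
      (fun r : ℝ => 2 * (s + 1) * r * (1 - r ^ 2) ^ s * r ^ (2 * k)) volume 0 1 := fun k =>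
    ((intervalIntegrable_iff_integrableOn_Ioc_of_le zero_le_one).2
      (radial_integral hs).1).mul_continuousOn (by fun_prop)
  induction n with
  | zero => simpa [monomialWeight_zero hs] using (radial_integral hs).2
  | succ n ih =>
    have hs1 : 0 < s + 1 := by linarith
    have hn : (0 : ℝ) ≤ n := n.cast_nonneg
    -- Integration by parts: this function vanishes at 0 and at 1, and its derivative combines two
    -- consecutive moment densities. So (s+2+n) I_{n+1} = (n+1) I_n, the recursion of the inverse
    -- weights.
    have hc : ContinuousOn (fun r : ℝ => -(r ^ (2 * (n + 1)) * (1 - r ^ 2) ^ (s + 1)))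
        (Set.Icc 0 1) := by
      refine (ContinuousOn.mul (by fun_prop) (ContinuousOn.rpow_const (by fun_prop) ?_)).neg
      intro x _
      right; linarith
    have hd : ∀ r ∈ Set.Ioo (0 : ℝ) 1, HasDerivAt
        (fun r : ℝ => -(r ^ (2 * (n + 1)) * (1 - r ^ 2) ^ (s + 1)))
        ((s + 2 + n) / (s + 1) * (2 * (s + 1) * r * (1 - r ^ 2) ^ s * r ^ (2 * (n + 1))) -
          (n + 1) / (s + 1) * (2 * (s + 1) * r * (1 - r ^ 2) ^ s * r ^ (2 * n))) r := by
      intro r hr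
      have h1 : 0 < 1 - r ^ 2 := by nlinarith [hr.1, hr.2]
      have h2 : HasDerivAt (fun r : ℝ => 1 - r ^ 2) (-(2 * r)) r := by
        simpa using (hasDerivAt_pow 2 r).const_sub 1
      have h3 := ((hasDerivAt_pow (2 * (n + 1)) r).mul
        (h2.rpow_const (p := s + 1) (Or.inl h1.ne'))).neg
      rw [add_sub_cancel_right, Real.rpow_add_one h1.ne'] at h3
      refine h3.congr_deriv ?_
      have e : 2 * (n + 1) - 1 = 2 * n + 1 := by omega
      rw [e]
      push_cast
      field_simp
      ring
    have h := intervalIntegral.integral_eq_sub_of_hasDerivAt_of_le zero_le_one hc hd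
      (((hint (n + 1)).const_mul _).sub ((hint n).const_mul _))
    rw [intervalIntegral.integral_sub ((hint (n + 1)).const_mul _) ((hint n).const_mul _),
      intervalIntegral.integral_const_mul, intervalIntegral.integral_const_mul, ih] at h
    have hb : -((1 : ℝ) ^ (2 * (n + 1)) * (1 - 1 ^ 2) ^ (s + 1)) -
        -((0 : ℝ) ^ (2 * (n + 1)) * (1 - 0 ^ 2) ^ (s + 1)) = 0 := by
      simp [Real.zero_rpow hs1.ne']
    rw [hb, sub_eq_zero] at h
    have hw := (monomialWeight_pos hs n).ne'
    have h3 : s + 2 + n ≠ 0 := by linarith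
    rw [monomialWeight_succ hs, mul_inv, inv_div]
    field_simp at h ⊢
    linarith

/-! ### Taylor coefficients on the disk -/

/-- `a` is the sequence of Taylor coefficients at `0` of `g`, which is holomorphic on the disk. -/
def HasTaylorCoeff (g : ℂ → ℂ) (a : ℕ → ℂ) : Prop :=
  ∀ z ∈ disk, HasSum (fun n => a n * z ^ n) (g z)

theorem exists_hasTaylorCoeff {g : ℂ → ℂ} (hg : DifferentiableOn ℂ g disk) :
    ∃ a, HasTaylorCoeff g a := by
  refine ⟨fun n => (n.factorial : ℂ)⁻¹ * iteratedDeriv n g 0, fun z hz => ?_⟩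
  refine (Complex.hasSum_taylorSeries_on_ball hg hz).congr_fun fun n => ?_
  simp only [smul_eq_mul, sub_zero]
  ring

/-- Cauchy product of absolutely convergent series. Only a_0, …, a_n enter the n-th coefficient,
which is why the adjoint of a multiplication sends e_n to a finite combination. -/
theorem HasTaylorCoeff.mul {g h : ℂ → ℂ} {a b : ℕ → ℂ} (hg : HasTaylorCoeff g a)
    (hh : HasTaylorCoeff h b) : HasTaylorCoeff (fun z => g z * h z)
      (fun n => ∑ k ∈ Finset.range (n + 1), a k * b (n - k)) := by
  intro z hz
  have h1 := (hg z hz).summable.norm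
  have h2 := (hh z hz).summable.norm
  have h3 := (summable_norm_sum_mul_range_of_summable_norm h1 h2).of_norm.hasSum
  rw [← tsum_mul_tsum_eq_tsum_sum_range_of_summable_norm h1 h2, (hg z hz).tsum_eq,
    (hh z hz).tsum_eq] at h3
  refine h3.congr_fun fun n => ?_
  rw [Finset.sum_mul]
  refine Finset.sum_congr rfl fun k hk => ?_
  have : z ^ n = z ^ k * z ^ (n - k) := by
    rw [← pow_add, Nat.add_sub_cancel' (Nat.lt_succ_iff.1 (Finset.mem_range.1 hk))]
  rw [this]
  ring

/-- The series converges absolutely on the circle of radius r, so it may be integrated term by term,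
and orthogonality of the characters e^{ikθ} leaves only m = n. -/
theorem HasTaylorCoeff.circle_integral {g : ℂ → ℂ} {a : ℕ → ℂ} (hg : HasTaylorCoeff g a)
    (n : ℕ) {r : ℝ} (hr : r ∈ Set.Ioo (0 : ℝ) 1) :
    ∫ θ in (-Real.pi)..Real.pi, starRingEnd ℂ (circleMap 0 r θ ^ n) * g (circleMap 0 r θ) =
      2 * Real.pi * a n * r ^ (2 * n) := by
  have hmem : ∀ θ, circleMap 0 r θ ∈ disk := fun θ => by
    rw [disk, mem_ball_zero_iff, norm_circleMap_zero, abs_of_pos hr.1]; exact hr.2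
  have hsum : Summable fun m => ‖a m‖ * r ^ m := by
    have := (hg r (by simpa [disk, abs_of_pos hr.1] using hr.2)).summable.norm
    simpa [abs_of_pos hr.1] using this
  have h1 : HasSum (fun m => ∫ θ in (-Real.pi)..Real.pi,
      starRingEnd ℂ (circleMap 0 r θ ^ n) * (a m * circleMap 0 r θ ^ m))
      (∫ θ in (-Real.pi)..Real.pi, starRingEnd ℂ (circleMap 0 r θ ^ n) * g (circleMap 0 r θ)) := by
    refine intervalIntegral.hasSum_integral_of_dominated_convergence
      (fun m _ => r ^ n * (‖a m‖ * r ^ m)) (fun m => ?_) (fun m => ?_) ?_ ?_ ?_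
    · exact (by fun_prop : Continuous _).aestronglyMeasurable
    · refine ae_of_all _ fun θ _ => ?_
      simp [abs_of_pos hr.1]
    · exact ae_of_all _ fun θ _ => hsum.mul_left _
    · exact intervalIntegrable_const
    · exact ae_of_all _ fun θ _ => (hg _ (hmem θ)).mul_left _
  have h2 : ∀ m, ∫ θ in (-Real.pi)..Real.pi,
      starRingEnd ℂ (circleMap 0 r θ ^ n) * (a m * circleMap 0 r θ ^ m) =
        if m = n then 2 * Real.pi * a n * r ^ (2 * n) else 0 := by
    intro m
    have e : ∀ θ : ℝ, starRingEnd ℂ (circleMap 0 r θ ^ n) * (a m * circleMap 0 r θ ^ m) =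
        a m * r ^ (n + m) * Complex.exp ((((m : ℤ) - n : ℤ) * Complex.I) * θ) := by
      intro θ
      have e1 : ((((m : ℤ) - n : ℤ) * Complex.I) * θ : ℂ) =
          n * (-(θ * Complex.I)) + m * (θ * Complex.I) := by push_cast; ring
      rw [e1, Complex.exp_add, Complex.exp_nat_mul, Complex.exp_nat_mul]
      simp only [circleMap, zero_add, map_pow, map_mul, Complex.conj_ofReal, ← Complex.exp_conj,
        Complex.conj_I, mul_pow, pow_add, mul_neg]
      ring
    simp only [e]
    rw [intervalIntegral.integral_const_mul]
    split_ifs with h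
    · subst h
      simp
      ring
    · have hk : ((m : ℤ) - n : ℤ) ≠ 0 := by omega
      set k : ℤ := (m : ℤ) - n
      have hkI : (k : ℂ) * Complex.I ≠ 0 := mul_ne_zero (by exact_mod_cast hk) Complex.I_ne_zero
      rw [integral_exp_mul_complex hkI]
      have : Complex.exp (k * Complex.I * (Real.pi : ℂ)) =
          Complex.exp (k * Complex.I * ((-Real.pi : ℝ) : ℂ)) := by
        rw [Complex.exp_eq_exp_iff_exists_int]
        exact ⟨k, by push_cast; ring⟩
      rw [this]
      simp
  simp only [h2] at h1
  exact h1.unique (hasSum_ite_eq n _)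

/-- Integrating a holomorphic function against a conjugate monomial extracts its
Taylor coefficient. -/
theorem HasTaylorCoeff.integral_conj_pow_mul {s : ℝ} (hs : -1 < s) {g : ℂ → ℂ} {a : ℕ → ℂ}
    (hg : HasTaylorCoeff g a) (hd : DifferentiableOn ℂ g disk)
    (hL : MemLp g 2 (weightedArea s)) (n : ℕ) :
    ∫ z, starRingEnd ℂ (z ^ n) * g z ∂(weightedArea s) = a n / monomialWeight s n := by
  have hI : Integrable (fun z => starRingEnd ℂ (z ^ n) * g z) (weightedArea s) := by
    refine (hL.integrable one_le_two).bdd_mul (c := 1)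
      (by fun_prop : Continuous _).aestronglyMeasurable ?_
    filter_upwards [ae_mem_disk s] with z hz
    have hz1 : ‖z‖ < 1 := by simpa [disk] using hz
    rw [RCLike.norm_conj, norm_pow]
    exact pow_le_one₀ (norm_nonneg _) hz1.le
  have hc : ContinuousOn (fun z => starRingEnd ℂ (z ^ n) * g z) disk :=
    ContinuousOn.mul (by fun_prop) hd.continuousOn
  rw [integral_weightedArea_polar hs hc hI]
  have h1 : ∀ r ∈ Set.Ioo (0 : ℝ) 1, ∫ θ in Set.Ioo (-Real.pi) Real.pi,
      (r * ((s + 1) / Real.pi * (1 - r ^ 2) ^ s)) •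
        (starRingEnd ℂ (circleMap 0 r θ ^ n) * g (circleMap 0 r θ)) =
      ((2 * (s + 1) * r * (1 - r ^ 2) ^ s * r ^ (2 * n) : ℝ) : ℂ) * a n := by
    intro r hr
    rw [integral_smul, ← integral_Ioc_eq_integral_Ioo,
      ← intervalIntegral.integral_of_le (by linarith [Real.pi_pos]), hg.circle_integral n hr,
      Complex.real_smul]
    have : (Real.pi : ℂ) ≠ 0 := by exact_mod_cast Real.pi_ne_zero
    push_cast
    field_simp
  rw [setIntegral_congr_fun measurableSet_Ioo h1, integral_mul_const, integral_complex_ofReal,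
    ← integral_Ioc_eq_integral_Ioo, ← intervalIntegral.integral_of_le zero_le_one,
    radial_moment hs]
  push_cast
  ring

/-! ### Holomorphic representatives and weighted composition -/

theorem isOpen_disk : IsOpen disk := Metric.isOpen_ball

theorem mem_disk {z : ℂ} : z ∈ disk ↔ ‖z‖ < 1 := by simp [disk]

theorem aestronglyMeasurable_of_differentiableOn (s : ℝ) {g : ℂ → ℂ}
    (hg : DifferentiableOn ℂ g disk) : AEStronglyMeasurable g (weightedArea s) :=
  (hg.continuousOn.aestronglyMeasurable isOpen_disk.measurableSet).mono_ac
    (withDensity_absolutelyContinuous _ _)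

/-- Holomorphic functions that agree almost everywhere agree on the disk. -/
theorem eqOn_of_ae_eq {s : ℝ} (hs : -1 < s) {g h : ℂ → ℂ} (hg : DifferentiableOn ℂ g disk)
    (hh : DifferentiableOn ℂ h disk) (he : g =ᵐ[weightedArea s] h) : Set.EqOn g h disk := by
  intro z hz
  have hz1 := mem_disk.1 hz
  -- Point evaluation is bounded by the L² norm on a closed disk containing z; the radius is the
  -- midpoint of ‖z‖ and 1.
  obtain ⟨K, -, hKg⟩ := enorm_le_eLpNorm hs (ρ := (1 + ‖z‖) / 2) (by positivity) (by linarith)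
  have h1 := hKg (g - h) (hg.sub hh) z (by simp; linarith)
  have h2 : eLpNorm (g - h) 2 (weightedArea s) = 0 := by
    rw [eLpNorm_congr_ae (g := 0) (by filter_upwards [he] with w hw; simp [hw]), eLpNorm_zero]
  rw [h2, mul_zero, nonpos_iff_eq_zero, enorm_eq_zero, Pi.sub_apply] at h1
  exact sub_eq_zero.1 h1

theorem IsHolomorphicRep.eqOn {s : ℝ} (hs : -1 < s) {f : Lp ℂ 2 (weightedArea s)} {g h : ℂ → ℂ}
    (hg : IsHolomorphicRep f g) (hh : IsHolomorphicRep f h) : Set.EqOn g h disk :=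
  eqOn_of_ae_eq hs hg.1 hh.1 (hg.2.symm.trans hh.2)

theorem IsHolomorphicRep.congr {s : ℝ} {f : Lp ℂ 2 (weightedArea s)} {g h : ℂ → ℂ}
    (hg : IsHolomorphicRep f g) (he : Set.EqOn g h disk) : IsHolomorphicRep f h := by
  refine ⟨hg.1.congr fun z hz => (he hz).symm, ?_⟩
  filter_upwards [hg.2, ae_mem_disk s] with z h1 h2
  rw [h1, he h2]

theorem IsHolomorphicRep.enorm_eq {s : ℝ} {f : bergmanSpace s} {g : ℂ → ℂ}
    (hg : IsHolomorphicRep (f : Lp ℂ 2 (weightedArea s)) g) :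
    ‖f‖ₑ = eLpNorm g 2 (weightedArea s) := by
  rw [← eLpNorm_congr_ae hg.2, ← Lp.enorm_def]
  rfl

theorem IsHolomorphicRep.memLp {s : ℝ} {f : Lp ℂ 2 (weightedArea s)} {g : ℂ → ℂ}
    (hg : IsHolomorphicRep f g) : MemLp g 2 (weightedArea s) :=
  (memLp_congr_ae hg.2).1 (Lp.memLp f)

theorem ext_of_isHolomorphicRep {s : ℝ} {f₁ f₂ : bergmanSpace s} {g₁ g₂ : ℂ → ℂ}
    (h₁ : IsHolomorphicRep (f₁ : Lp ℂ 2 (weightedArea s)) g₁)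
    (h₂ : IsHolomorphicRep (f₂ : Lp ℂ 2 (weightedArea s)) g₂) (he : Set.EqOn g₁ g₂ disk) :
    f₁ = f₂ := by
  refine Subtype.ext (Lp.ext ?_)
  exact (h₁.congr he).2.trans h₂.2.symm

theorem IsHolomorphicRep.add {s : ℝ} {f₁ f₂ : Lp ℂ 2 (weightedArea s)} {g₁ g₂ : ℂ → ℂ}
    (h₁ : IsHolomorphicRep f₁ g₁) (h₂ : IsHolomorphicRep f₂ g₂) :
    IsHolomorphicRep (f₁ + f₂) (g₁ + g₂) :=
  ⟨h₁.1.add h₂.1, (Lp.coeFn_add f₁ f₂).trans (h₁.2.add h₂.2)⟩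

theorem IsHolomorphicRep.smul {s : ℝ} {f : Lp ℂ 2 (weightedArea s)} {g : ℂ → ℂ} (c : ℂ)
    (h : IsHolomorphicRep f g) : IsHolomorphicRep (c • f) (c • g) :=
  ⟨h.1.const_smul c, (Lp.coeFn_smul c f).trans (h.2.const_smul c)⟩

/-- A square-integrable holomorphic function, as an element of the Bergman space. -/
theorem exists_isHolomorphicRep {s : ℝ} {g : ℂ → ℂ} (hg : DifferentiableOn ℂ g disk)
    (hL : MemLp g 2 (weightedArea s)) :
    ∃ f : bergmanSpace s, IsHolomorphicRep (f : Lp ℂ 2 (weightedArea s)) g :=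
  ⟨⟨hL.toLp, g, hg, hL.coeFn_toLp⟩, hg, hL.coeFn_toLp⟩

/-- A weighted composition satisfying a norm bound defines a bounded operator. -/
theorem exists_weightedComposition {s : ℝ} (hs : -1 < s) {φ w : ℂ → ℂ}
    (hφ : DifferentiableOn ℂ φ disk) (hmaps : Set.MapsTo φ disk disk)
    (hw : DifferentiableOn ℂ w disk) (K : NNReal)
    (hK : ∀ g, DifferentiableOn ℂ g disk →
      eLpNorm (fun z => w z * g (φ z)) 2 (weightedArea s) ≤ K * eLpNorm g 2 (weightedArea s)) :
    ∃ T : bergmanSpace s →L[ℂ] bergmanSpace s, ∀ (f : bergmanSpace s) (g : ℂ → ℂ),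
      IsHolomorphicRep (f : Lp ℂ 2 (weightedArea s)) g →
        IsHolomorphicRep (T f : Lp ℂ 2 (weightedArea s)) (fun z => w z * g (φ z)) := by
  have hdiff : ∀ g, DifferentiableOn ℂ g disk →
      DifferentiableOn ℂ (fun z => w z * g (φ z)) disk := fun g hg => hw.mul (hg.comp hφ hmaps)
  -- The image must serve every representative g of f at once, so that the chosen map is linear by
  -- uniqueness of the represented class.
  have hex : ∀ f : bergmanSpace s, ∃ f' : bergmanSpace s, ∀ g : ℂ → ℂ,
      IsHolomorphicRep (f : Lp ℂ 2 (weightedArea s)) g →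
        IsHolomorphicRep (f' : Lp ℂ 2 (weightedArea s)) (fun z => w z * g (φ z)) := by
    intro f
    obtain ⟨g, hg⟩ := f.2
    obtain ⟨f', hf'⟩ := exists_isHolomorphicRep (s := s) (hdiff g hg.1)
      ⟨aestronglyMeasurable_of_differentiableOn s (hdiff g hg.1),
        (hK g hg.1).trans_lt (ENNReal.mul_lt_top ENNReal.coe_lt_top hg.memLp.2)⟩
    refine ⟨f', fun h hh => hf'.congr fun z hz => ?_⟩
    simp only
    rw [hg.eqOn hs hh (hmaps hz)]
  choose T hT using hex
  have hbound : ∀ f, ‖T f‖ ≤ K * ‖f‖ := by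
    intro f
    obtain ⟨g, hg⟩ := f.2
    have h := hK g hg.1
    rw [← (hT f g hg).enorm_eq, ← hg.enorm_eq, enorm_eq_nnnorm, enorm_eq_nnnorm] at h
    exact_mod_cast h
  refine ⟨LinearMap.mkContinuous
    { toFun := T
      map_add' := fun f₁ f₂ => ?_
      map_smul' := fun c f => ?_ } K hbound, hT⟩
  · obtain ⟨g₁, h₁⟩ := f₁.2
    obtain ⟨g₂, h₂⟩ := f₂.2
    refine ext_of_isHolomorphicRep (hT _ _ (h₁.add h₂))
      (f₂ := T f₁ + T f₂) ((hT _ _ h₁).add (hT _ _ h₂)) fun z _ => ?_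
    simp [mul_add]
  · obtain ⟨g, h⟩ := f.2
    refine ext_of_isHolomorphicRep (hT _ _ (h.smul c))
      (f₂ := c • T f) ((hT _ _ h).smul c) fun z _ => ?_
    simp only [Pi.smul_apply, smul_eq_mul]
    ring

/-! ### Change of variables and disk automorphisms -/

/-- Change of variables for `dv_s` under an injective holomorphic map of the disk onto itself. -/
theorem lintegral_comp_mul_enorm_sq {s : ℝ} (hs : -1 < s) {φ φ' k : ℂ → ℂ}
    (hd : ∀ z ∈ disk, HasDerivAt φ (φ' z) z) (hinj : Set.InjOn φ disk) (himg : φ '' disk = disk)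
    (hk : ∀ z ∈ disk, (1 - ‖φ z‖ ^ 2) ^ s * ‖φ' z‖ ^ 2 = (1 - ‖z‖ ^ 2) ^ s * ‖k z‖ ^ 2)
    (F : ℂ → ℝ≥0∞) :
    ∫⁻ z, ‖k z‖ₑ ^ 2 * F (φ z) ∂(weightedArea s) = ∫⁻ z, F z ∂(weightedArea s) := by
  have hm : MeasurableSet disk := isOpen_disk.measurableSet
  have hwm : Measurable (fun z : ℂ => ENNReal.ofReal ((s + 1) / Real.pi * (1 - ‖z‖ ^ 2) ^ s)) := by
    fun_prop
  have hfin : ∀ᵐ z : ℂ ∂(volume.restrict disk),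
      ENNReal.ofReal ((s + 1) / Real.pi * (1 - ‖z‖ ^ 2) ^ s) < ∞ :=
    ae_of_all _ fun _ => ENNReal.ofReal_lt_top
  -- F is arbitrary, so the density is unfolded in the form that needs only a density finite almost
  -- everywhere.
  rw [weightedArea, lintegral_withDensity_eq_lintegral_mul_non_measurable _ hwm hfin,
    lintegral_withDensity_eq_lintegral_mul_non_measurable _ hwm hfin]
  have h := lintegral_image_eq_lintegral_abs_det_fderiv_mul volume hm
    (fun z hz => ((hd z hz).hasFDerivAt.restrictScalars ℝ).hasFDerivWithinAt) hinj
    (fun z => ENNReal.ofReal ((s + 1) / Real.pi * (1 - ‖z‖ ^ 2) ^ s) * F z)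
  rw [himg] at h
  simp only [Pi.mul_apply]
  rw [h]
  refine setLIntegral_congr_fun hm fun z hz => ?_
  rw [← mul_assoc, ← mul_assoc]
  congr 1
  have hpos : ∀ w ∈ disk, 0 ≤ (1 - ‖w‖ ^ 2) ^ s := fun w hw => by
    have := mem_disk.1 hw
    exact Real.rpow_nonneg (by nlinarith [norm_nonneg w]) _
  have hc : 0 ≤ (s + 1) / Real.pi := div_nonneg (by linarith) Real.pi_pos.le
  -- The real Jacobian of multiplication by a complex number is its squared modulus.
  have hdet : ((ContinuousLinearMap.toSpanSingleton ℂ (φ' z)).restrictScalars ℝ).det =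
      ‖φ' z‖ ^ 2 := by
    simp [ContinuousLinearMap.det, LinearMap.det_restrictScalars, Algebra.norm_complex_eq,
      Complex.normSq_eq_norm_sq]
  rw [hdet, abs_of_nonneg (sq_nonneg _), ← ofReal_norm, ← ENNReal.ofReal_pow (norm_nonneg _),
    ← ENNReal.ofReal_mul (mul_nonneg hc (hpos z hz)), ← ENNReal.ofReal_mul (sq_nonneg _)]
  congr 1
  linear_combination (-((s + 1) / Real.pi)) * hk z hz

theorem one_sub_conj_mul_ne_zero {p z : ℂ} (hp : p ∈ disk) (hz : z ∈ disk) :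
    1 - starRingEnd ℂ p * z ≠ 0 := by
  intro h
  have h1 : ‖starRingEnd ℂ p * z‖ < 1 := by
    rw [norm_mul, RCLike.norm_conj]
    exact mul_lt_one_of_nonneg_of_lt_one_left (norm_nonneg _) (mem_disk.1 hp) (mem_disk.1 hz).le
  rw [← sub_eq_zero.1 h] at h1
  simp at h1

/-- The involutive automorphism of the disk that exchanges `0` and `p`. -/
noncomputable def diskInvolution (p z : ℂ) : ℂ := (p - z) / (1 - starRingEnd ℂ p * z)

/-- From |1 - p̄z|² - |p - z|² = (1 - |p|²)(1 - |z|²). The factor Q = (1 - |p|²)/|1 - p̄z|² is also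
the modulus of the derivative of the involution, so the weight contributes Q^s and the Jacobian Q²;
hence the exponent s+2. -/
theorem one_sub_norm_diskInvolution_sq {p z : ℂ} (hp : p ∈ disk) (hz : z ∈ disk) :
    1 - ‖diskInvolution p z‖ ^ 2 =
      (1 - ‖p‖ ^ 2) / ‖1 - starRingEnd ℂ p * z‖ ^ 2 * (1 - ‖z‖ ^ 2) := by
  have h := norm_ne_zero_iff.2 (one_sub_conj_mul_ne_zero hp hz)
  rw [diskInvolution, norm_div, div_pow, div_mul_eq_mul_div, eq_div_iff (pow_ne_zero 2 h),
    sub_mul, div_mul_cancel₀ _ (pow_ne_zero 2 h)]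
  simp only [← Complex.normSq_eq_norm_sq, Complex.normSq_apply, Complex.sub_re, Complex.sub_im,
    Complex.mul_re, Complex.mul_im, Complex.conj_re, Complex.conj_im, Complex.one_re,
    Complex.one_im]
  ring

theorem mapsTo_diskInvolution {p : ℂ} (hp : p ∈ disk) :
    Set.MapsTo (diskInvolution p) disk disk := by
  intro z hz
  have h := norm_pos_iff.2 (one_sub_conj_mul_ne_zero hp hz)
  have h1 := mem_disk.1 hp
  have h2 := mem_disk.1 hz
  have h3 : 0 < 1 - ‖p‖ ^ 2 := by nlinarith [norm_nonneg p]
  have h4 : 0 < 1 - ‖z‖ ^ 2 := by nlinarith [norm_nonneg z]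
  have h5 : 0 < 1 - ‖diskInvolution p z‖ ^ 2 := by
    rw [one_sub_norm_diskInvolution_sq hp hz]; positivity
  rw [mem_disk]
  nlinarith [norm_nonneg (diskInvolution p z)]

theorem diskInvolution_diskInvolution {p z : ℂ} (hp : p ∈ disk) (hz : z ∈ disk) :
    diskInvolution p (diskInvolution p z) = z := by
  have h := one_sub_conj_mul_ne_zero hp hz
  have h' := one_sub_conj_mul_ne_zero hp hp
  rw [diskInvolution, diskInvolution, mul_div_assoc', sub_div' h, sub_div' h,
    div_div_div_cancel_right₀ h, div_eq_iff]
  · ring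
  · convert h' using 1; ring

theorem hasDerivAt_diskInvolution {p z : ℂ} (hp : p ∈ disk) (hz : z ∈ disk) :
    HasDerivAt (diskInvolution p)
      (-((1 - starRingEnd ℂ p * p) / (1 - starRingEnd ℂ p * z) ^ 2)) z := by
  have h := one_sub_conj_mul_ne_zero hp hz
  have h1 : HasDerivAt (fun z => p - z) (-1) z := (hasDerivAt_id z).const_sub p
  have h2 : HasDerivAt (fun z => 1 - starRingEnd ℂ p * z) (-(starRingEnd ℂ p)) z := by
    simpa using ((hasDerivAt_id z).const_mul (starRingEnd ℂ p)).const_sub 1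
  refine (h1.div h2 h).congr_deriv ?_
  rw [← neg_div]
  congr 1
  ring

theorem differentiableOn_diskInvolution {p : ℂ} (hp : p ∈ disk) :
    DifferentiableOn ℂ (diskInvolution p) disk := fun _ hz =>
  (hasDerivAt_diskInvolution hp hz).differentiableAt.differentiableWithinAt

/-- A disk automorphism vanishing at `p` is a rotation of the involution exchanging `0`, `p`. -/
theorem IsDiskAutomorphism.exists_eq_mul_diskInvolution {φ : ℂ → ℂ} (hφ : IsDiskAutomorphism φ)
    {p : ℂ} (hp : p ∈ disk) (hφp : φ p = 0) :
    ∃ c : ℂ, ‖c‖ = 1 ∧ ∀ z ∈ disk, φ z = c * diskInvolution p z := by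
  obtain ⟨hφd, hφm, ψ, hψd, hψm, hl, hr⟩ := hφ
  have h0 : (0 : ℂ) ∈ disk := by simp [disk]
  have hτd := differentiableOn_diskInvolution hp
  have hτm := mapsTo_diskInvolution hp
  have hτ0 : diskInvolution p 0 = p := by simp [diskInvolution]
  have hτp : diskInvolution p p = 0 := by simp [diskInvolution]
  -- Precomposing with the involution moves the zero of φ to 0; the Schwarz lemma then applies to F
  -- and to its left inverse G.
  set F : ℂ → ℂ := fun z => φ (diskInvolution p z) with hF
  set G : ℂ → ℂ := fun z => diskInvolution p (ψ z) with hG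
  have hFd : DifferentiableOn ℂ F disk := hφd.comp hτd hτm
  have hGd : DifferentiableOn ℂ G disk := hτd.comp hψd hψm
  have hFm : Set.MapsTo F disk disk := hφm.comp hτm
  have hGm : Set.MapsTo G disk disk := hτm.comp hψm
  have hF0 : F 0 = 0 := by simp only [hF, hτ0, hφp]
  have hG0 : G 0 = 0 := by
    have := hl hp
    rw [hφp] at this
    simp only [hG, this, hτp]
  have hGF : ∀ z ∈ disk, G (F z) = z := fun z hz => by
    simp only [hG, hF]
    rw [hl (hτm hz), diskInvolution_diskInvolution hp hz]
  have hcl : ∀ {f : ℂ → ℂ}, Set.MapsTo f disk disk →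
      Set.MapsTo f (Metric.ball 0 1) (Metric.closedBall 0 1) := fun hf z hz =>
    Metric.ball_subset_closedBall (hf hz)
  -- Schwarz for F gives ≤; Schwarz for G at F z gives ≥.
  have hnorm : ∀ z ∈ disk, ‖F z‖ = ‖z‖ := by
    intro z hz
    refine le_antisymm (Complex.norm_le_norm_of_mapsTo_ball hFd (hcl hFm) hF0 (mem_disk.1 hz)) ?_
    have := Complex.norm_le_norm_of_mapsTo_ball hGd (hcl hGm) hG0 (mem_disk.1 (hFm hz))
    rwa [hGF z hz] at this
  -- Equality in the Schwarz lemma at one nonzero point forces F to be linear; 1/2 is an arbitrary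
  -- such point.
  have hhalf : (1 / 2 : ℂ) ∈ disk := by rw [mem_disk]; norm_num
  have hds : ‖dslope F 0 (1 / 2)‖ = 1 / 1 := by
    rw [dslope_of_ne _ (by norm_num), slope_def_field, hF0, sub_zero, sub_zero, norm_div,
      hnorm _ hhalf]
    norm_num
  have hlin := Complex.affine_of_mapsTo_ball_of_norm_dslope_eq_div (R₂ := 1) hFd
    (by rw [hF0]; exact hcl hFm) hhalf hds
  refine ⟨dslope F 0 (1 / 2), by simpa using hds, fun z hz => ?_⟩
  have h1 := hlin (hτm hz)
  simp only [hF0, sub_zero, zero_add, smul_eq_mul] at h1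
  rw [mul_comm, ← h1]
  simp only [hF]
  rw [diskInvolution_diskInvolution hp hz]

-- Orthonormal monomials and adjoints of multiplications

local notation "⟪" x ", " y "⟫" => inner ℂ x y

theorem isHolomorphicRep_normalizedMonomial (s : ℝ) (n : ℕ) :
    IsHolomorphicRep (normalizedMonomial s n : Lp ℂ 2 (weightedArea s))
      (fun z => (√(monomialWeight s n) : ℝ) * z ^ n) :=
  ⟨by fun_prop, (memLp_monomial s _ n).coeFn_toLp⟩

/-- The integral against the conjugate monomial is a_n / w_n, and the factor √w_n of e_n turns this
into a_n / √w_n. -/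
theorem inner_normalizedMonomial {s : ℝ} (hs : -1 < s) {f : bergmanSpace s} {g : ℂ → ℂ}
    {a : ℕ → ℂ} (hf : IsHolomorphicRep (f : Lp ℂ 2 (weightedArea s)) g)
    (ha : HasTaylorCoeff g a) (n : ℕ) :
    ⟪normalizedMonomial s n, f⟫ = a n / (√(monomialWeight s n) : ℝ) := by
  have h1 : ∀ᵐ z ∂(weightedArea s),
      ⟪(normalizedMonomial s n : Lp ℂ 2 (weightedArea s)) z, (f : Lp ℂ 2 (weightedArea s)) z⟫ =
        (√(monomialWeight s n) : ℝ) * (starRingEnd ℂ (z ^ n) * g z) := by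
    filter_upwards [hf.2, (isHolomorphicRep_normalizedMonomial s n).2] with z h2 h3
    rw [h2, h3, RCLike.inner_apply, map_mul, Complex.conj_ofReal]
    ring
  rw [Submodule.coe_inner, L2.inner_def, integral_congr_ae h1, integral_const_mul,
    ha.integral_conj_pow_mul hs hf.1 hf.memLp]
  have hw := monomialWeight_pos hs n
  have h4 : ((√(monomialWeight s n) : ℝ) : ℂ) ≠ 0 := by
    exact_mod_cast (Real.sqrt_pos.2 hw).ne'
  have h5 : (monomialWeight s n : ℂ) = (√(monomialWeight s n) : ℝ) * (√(monomialWeight s n) : ℝ) := by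
    rw [← Complex.ofReal_mul, Real.mul_self_sqrt hw.le]
  rw [h5]
  field_simp

theorem orthonormal_normalizedMonomial {s : ℝ} (hs : -1 < s) :
    Orthonormal ℂ (normalizedMonomial s) := by
  rw [orthonormal_iff_ite]
  intro n m
  have ha : HasTaylorCoeff (fun z => (√(monomialWeight s m) : ℝ) * z ^ m)
      (fun k => if k = m then ((√(monomialWeight s m) : ℝ) : ℂ) else 0) := by
    intro z _
    refine (hasSum_ite_eq m (((√(monomialWeight s m) : ℝ) : ℂ) * z ^ m)).congr_fun fun k => ?_
    by_cases h : k = m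
    · subst h; simp
    · simp [h]
  rw [inner_normalizedMonomial hs (isHolomorphicRep_normalizedMonomial s m) ha]
  split_ifs with h
  · subst h
    exact div_self (by exact_mod_cast (Real.sqrt_pos.2 (monomialWeight_pos hs n)).ne')
  · simp

/-- The adjoint of multiplication by a holomorphic function maps `e_n` to an explicit
combination of `e_0, …, e_n`. -/
theorem adjoint_mul_normalizedMonomial {s : ℝ} (hs : -1 < s) {h : ℂ → ℂ} {b : ℕ → ℂ}
    (hb : HasTaylorCoeff h b) {M : bergmanSpace s →L[ℂ] bergmanSpace s}
    (hM : ∀ (f : bergmanSpace s) (g : ℂ → ℂ), IsHolomorphicRep (f : Lp ℂ 2 (weightedArea s)) g →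
      IsHolomorphicRep (M f : Lp ℂ 2 (weightedArea s)) (fun z => h z * g z)) (n : ℕ) :
    ContinuousLinearMap.adjoint M (normalizedMonomial s n) =
      ∑ m ∈ Finset.range (n + 1), (starRingEnd ℂ (b (n - m)) *
        (√(monomialWeight s m) / √(monomialWeight s n) : ℝ)) • normalizedMonomial s m := by
  -- Testing against every f turns the left side into a coefficient of the product h g, so
  -- completeness of the monomials is not needed.
  refine ext_inner_right ℂ fun f => ?_
  obtain ⟨g, hg⟩ := f.2
  obtain ⟨a, ha⟩ := exists_hasTaylorCoeff hg.1
  rw [ContinuousLinearMap.adjoint_inner_left, inner_normalizedMonomial hs (hM f g hg) (hb.mul ha),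
    sum_inner, Finset.sum_div, ← Finset.sum_range_reflect]
  refine Finset.sum_congr rfl fun m hm => ?_
  have hmn : m ≤ n := Nat.lt_succ_iff.1 (Finset.mem_range.1 hm)
  have e1 : n + 1 - 1 - m = n - m := by omega
  have e2 : n - (n - m) = m := by omega
  have h4 : ((√(monomialWeight s m) : ℝ) : ℂ) ≠ 0 := by
    exact_mod_cast (Real.sqrt_pos.2 (monomialWeight_pos hs m)).ne'
  have e3 := inner_smul_left (𝕜 := ℂ) (normalizedMonomial s m) f
    (starRingEnd ℂ (b (n - m)) * (√(monomialWeight s m) / √(monomialWeight s n) : ℝ))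
  rw [e3, inner_normalizedMonomial hs hg ha, map_mul, Complex.conj_conj,
    Complex.conj_ofReal, e1, e2, Complex.ofReal_div]
  field_simp

/-- Pythagoras for the finite combination, reindexed by k = n - m so that b_k no longer depends on
n. -/
theorem norm_adjoint_mul_normalizedMonomial_sq {s : ℝ} (hs : -1 < s) {h : ℂ → ℂ} {b : ℕ → ℂ}
    (hb : HasTaylorCoeff h b) {M : bergmanSpace s →L[ℂ] bergmanSpace s}
    (hM : ∀ (f : bergmanSpace s) (g : ℂ → ℂ), IsHolomorphicRep (f : Lp ℂ 2 (weightedArea s)) g →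
      IsHolomorphicRep (M f : Lp ℂ 2 (weightedArea s)) (fun z => h z * g z)) (n : ℕ) :
    ‖ContinuousLinearMap.adjoint M (normalizedMonomial s n)‖ ^ 2 =
      ∑ k ∈ Finset.range (n + 1),
        ‖b k‖ ^ 2 * (monomialWeight s (n - k) / monomialWeight s n) := by
  have hsum := (orthonormal_normalizedMonomial hs).inner_sum
    (fun m => starRingEnd ℂ (b (n - m)) *
      ((√(monomialWeight s m) / √(monomialWeight s n) : ℝ) : ℂ))
    (fun m => starRingEnd ℂ (b (n - m)) *
      ((√(monomialWeight s m) / √(monomialWeight s n) : ℝ) : ℂ)) (Finset.range (n + 1))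
  rw [← adjoint_mul_normalizedMonomial hs hb hM n, inner_self_eq_norm_sq_to_K] at hsum
  rw [← Finset.sum_range_reflect]
  have : ((‖ContinuousLinearMap.adjoint M (normalizedMonomial s n)‖ ^ 2 : ℝ) : ℂ) =
      ((∑ m ∈ Finset.range (n + 1), ‖b (n - m)‖ ^ 2 *
        (monomialWeight s m / monomialWeight s n) : ℝ) : ℂ) := by
    rw [Complex.ofReal_pow, Complex.ofReal_sum]
    refine hsum.trans (Finset.sum_congr rfl fun m _ => ?_)
    rw [← Complex.normSq_eq_conj_mul_self, Complex.normSq_eq_norm_sq, norm_mul, RCLike.norm_conj,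
      Complex.norm_real, mul_pow, Real.norm_eq_abs, sq_abs, div_pow,
      Real.sq_sqrt (monomialWeight_pos hs m).le, Real.sq_sqrt (monomialWeight_pos hs n).le]
  rw [Complex.ofReal_inj.1 this]
  refine Finset.sum_congr rfl fun m hm => ?_
  have hmn : m ≤ n := Nat.lt_succ_iff.1 (Finset.mem_range.1 hm)
  have e1 : n + 1 - 1 - m = n - m := by omega
  have e2 : n - (n - m) = m := by omega
  rw [e1, e2]

/-! ### The limit and the binomial coefficients -/

/-- Dominated convergence for series: the terms, extended by 0 for k > n, are bounded by c k since
the weights increase, and tend to c k. -/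
theorem tendsto_sum_mul_monomialWeight_div {s : ℝ} (hs : -1 < s) {c : ℕ → ℝ}
    (hc0 : ∀ k, 0 ≤ c k) (hc : Summable c) :
    Tendsto (fun n : ℕ => ∑ k ∈ Finset.range (n + 1),
      c k * (monomialWeight s (n - k) / monomialWeight s n)) atTop (𝓝 (∑' k, c k)) := by
  have h := tendsto_tsum_of_dominated_convergence (𝓕 := atTop)
    (f := fun n k => if k ∈ Finset.range (n + 1) then
      c k * (monomialWeight s (n - k) / monomialWeight s n) else 0) (g := c) (bound := c) hc
    (fun k => ?_) (Eventually.of_forall fun n k => ?_)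
  · refine h.congr fun n => ?_
    rw [tsum_eq_sum (s := Finset.range (n + 1)) fun k hk => if_neg hk]
    exact Finset.sum_congr rfl fun k hk => if_pos hk
  -- Replacing n by n + k makes the truncated subtraction exact.
  · rw [← tendsto_add_atTop_iff_nat k]
    have h1 := (tendsto_monomialWeight_div_add hs k).const_mul (c k)
    rw [mul_one] at h1
    refine h1.congr fun n => ?_
    rw [if_pos (Finset.mem_range.2 (by omega)), Nat.add_sub_cancel]
  · have hpos := monomialWeight_pos hs n
    split_ifs
    · have h1 : monomialWeight s (n - k) / monomialWeight s n ≤ 1 :=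
        (div_le_one hpos).2 (monotone_monomialWeight hs (Nat.sub_le n k))
      have h2 : 0 ≤ monomialWeight s (n - k) / monomialWeight s n :=
        div_nonneg (monomialWeight_pos hs _).le hpos.le
      rw [Real.norm_of_nonneg (mul_nonneg (hc0 k) h2)]
      exact mul_le_of_le_one_right (hc0 k) h1
    · simpa using hc0 k

/-- The binomial series converges absolutely at x; the squares of its terms are the diagonal of the
summable family of products of two terms. -/
theorem summable_choose_sq_mul_pow (a : ℝ) {x : ℝ} (hx0 : 0 ≤ x) (hx : x < 1) :
    Summable (fun k : ℕ => Ring.choose a k ^ 2 * x ^ (2 * k)) := by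
  have h1 := (Complex.one_add_cpow_hasFPowerSeriesOnBall_zero (a := (a : ℂ))).hasSum
    (y := (x : ℂ)) (by simpa [← ofReal_norm, abs_of_nonneg hx0] using hx)
  have h2 : Summable fun k : ℕ => |Ring.choose a k| * x ^ k := by
    refine h1.summable.norm.congr fun k => ?_
    rw [binomialSeries_apply, ← Complex.ofReal_choose]
    simp [abs_of_nonneg hx0]
  have h0 : ∀ k : ℕ, 0 ≤ |Ring.choose a k| * x ^ k := fun k => by positivity
  refine ((h2.mul_of_nonneg h2 h0 h0).comp_injective (i := fun k : ℕ => (k, k))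
    fun i j h => (Prod.ext_iff.1 h).1).congr fun k => ?_
  simp only [Function.comp_apply]
  rw [← sq_abs (Ring.choose a k)]
  ring

/-! ### The multiplier symbol -/

/-- The symbol `(1 - p̄ z)^(s+2) / (1 - ‖p‖²)^((s+2)/2)`. -/
noncomputable def multiplierSymbol (s : ℝ) (p z : ℂ) : ℂ :=
  ((1 - ‖p‖ ^ 2) ^ (-((s + 2) / 2)) : ℝ) * (1 + -(starRingEnd ℂ p * z)) ^ ((s + 2 : ℝ) : ℂ)

theorem norm_conj_mul_lt_one {p z : ℂ} (hp : p ∈ disk) (hz : z ∈ disk) :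
    ‖starRingEnd ℂ p * z‖ < 1 := by
  rw [norm_mul, RCLike.norm_conj]
  exact mul_lt_one_of_nonneg_of_lt_one_left (norm_nonneg _) (mem_disk.1 hp) (mem_disk.1 hz).le

theorem one_sub_norm_sq_pos {p : ℂ} (hp : p ∈ disk) : 0 < 1 - ‖p‖ ^ 2 := by
  have := mem_disk.1 hp
  nlinarith [norm_nonneg p]

theorem multiplierSymbol_ne_zero (s : ℝ) {p z : ℂ} (hp : p ∈ disk) (hz : z ∈ disk) :
    multiplierSymbol s p z ≠ 0 := by
  refine mul_ne_zero (by exact_mod_cast (Real.rpow_pos_of_pos (one_sub_norm_sq_pos hp) _).ne') ?_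
  rw [Complex.cpow_ne_zero_iff, ← sub_eq_add_neg]
  exact Or.inl (one_sub_conj_mul_ne_zero hp hz)

/-- Since |p̄z| < 1, the base stays in the slit plane, where the principal power is holomorphic. -/
theorem differentiableOn_multiplierSymbol (s : ℝ) {p : ℂ} (hp : p ∈ disk) :
    DifferentiableOn ℂ (multiplierSymbol s p) disk := by
  refine DifferentiableOn.const_mul (DifferentiableOn.cpow_const (by fun_prop) fun z hz => ?_) _
  exact Complex.mem_slitPlane_of_norm_lt_one (by simpa using norm_conj_mul_lt_one hp hz)

theorem hasTaylorCoeff_multiplierSymbol (s : ℝ) {p : ℂ} (hp : p ∈ disk) :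
    HasTaylorCoeff (multiplierSymbol s p) (fun k => ((1 - ‖p‖ ^ 2) ^ (-((s + 2) / 2)) : ℝ) *
      (Ring.choose (s + 2) k : ℝ) * (-starRingEnd ℂ p) ^ k) := by
  intro z hz
  have h1 := (Complex.one_add_cpow_hasFPowerSeriesOnBall_zero (a := ((s + 2 : ℝ) : ℂ))).hasSum
    (y := -(starRingEnd ℂ p * z)) (by
      rw [Metric.mem_eball, edist_zero_right, ← ofReal_norm, norm_neg, ENNReal.ofReal_lt_one]
      exact norm_conj_mul_lt_one hp hz)
  rw [zero_add] at h1
  refine (h1.mul_left _).congr_fun fun k => ?_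
  rw [binomialSeries_apply, ← Complex.ofReal_choose]
  simp only [List.ofFn_const, List.prod_replicate, smul_eq_mul]
  rw [← neg_mul, mul_pow]
  ring

/-- Identifies |h|⁻² with Q^(s+2), the factor produced by the change of variables. The exponent is
real, so the modulus of the power is the power of the modulus. -/
theorem norm_multiplierSymbol_sq (s : ℝ) {p z : ℂ} (hp : p ∈ disk) (hz : z ∈ disk) :
    ‖multiplierSymbol s p z‖ ^ 2 =
      (((1 - ‖p‖ ^ 2) / ‖1 - starRingEnd ℂ p * z‖ ^ 2) ^ (s + 2))⁻¹ := by
  have hq := one_sub_norm_sq_pos hp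
  have hD := norm_pos_iff.2 (one_sub_conj_mul_ne_zero hp hz)
  rw [multiplierSymbol, ← sub_eq_add_neg, norm_mul, Complex.norm_cpow_real, Complex.norm_real,
    Real.norm_of_nonneg (Real.rpow_nonneg hq.le _)]
  generalize ‖1 - starRingEnd ℂ p * z‖ = D at *
  generalize 1 - ‖p‖ ^ 2 = q at *
  have h1 : (q ^ (-((s + 2) / 2))) ^ 2 = (q ^ (s + 2))⁻¹ := by
    rw [← Real.rpow_mul_natCast hq.le, ← Real.rpow_neg hq.le]
    congr 1
    push_cast
    ring
  have h2 : (D ^ 2) ^ (s + 2) = (D ^ (s + 2)) ^ 2 := Real.rpow_pow_comm hD.le _ _ |>.symm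
  rw [Real.div_rpow hq.le (by positivity), mul_pow, h1, h2, inv_div, div_eq_mul_inv, mul_comm]

theorem exists_norm_multiplierSymbol_le {s : ℝ} (hs : -1 < s) {p : ℂ} (hp : p ∈ disk) :
    ∃ K : NNReal, ∀ z ∈ disk, ‖multiplierSymbol s p z‖ₑ ≤ K := by
  have hq := one_sub_norm_sq_pos hp
  -- The 2 bounds |1 - p̄z|; the power is monotone since s + 2 > 0.
  refine ⟨((1 - ‖p‖ ^ 2) ^ (-((s + 2) / 2)) * 2 ^ (s + 2)).toNNReal, fun z hz => ?_⟩
  rw [← ofReal_norm]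
  refine ENNReal.ofReal_le_ofReal ?_
  rw [multiplierSymbol, norm_mul, Complex.norm_cpow_real, Complex.norm_real,
    Real.norm_of_nonneg (Real.rpow_nonneg hq.le _)]
  gcongr
  · linarith
  · refine (norm_add_le _ _).trans ?_
    rw [norm_neg, norm_one]
    linarith [norm_conj_mul_lt_one hp hz]

theorem eLpNorm_two_eq (s : ℝ) (g : ℂ → ℂ) :
    eLpNorm g 2 (weightedArea s) = (∫⁻ z, ‖g z‖ₑ ^ 2 ∂(weightedArea s)) ^ (1 / 2 : ℝ) := by
  rw [eLpNorm_eq_lintegral_rpow_enorm_toReal two_ne_zero ENNReal.ofNat_ne_top]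
  simp

/-! ### The unitary factor -/

/-- The automorphism `φ` and the reciprocal of the multiplier symbol satisfy the change of
variables formula. -/
theorem IsDiskAutomorphism.lintegral_comp {s : ℝ} (hs : -1 < s) {φ : ℂ → ℂ}
    (hφ : IsDiskAutomorphism φ) {p : ℂ} (hp : p ∈ disk) (hφp : φ p = 0) (F : ℂ → ℝ≥0∞) :
    ∫⁻ z, ‖(multiplierSymbol s p z)⁻¹‖ₑ ^ 2 * F (φ z) ∂(weightedArea s) =
      ∫⁻ z, F z ∂(weightedArea s) := by
  obtain ⟨c, hc, hφc⟩ := hφ.exists_eq_mul_diskInvolution hp hφp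
  obtain ⟨hφd, hφm, ψ, hψd, hψm, hl, hr⟩ := hφ
  refine lintegral_comp_mul_enorm_sq hs
    (φ' := fun z => c * -((1 - starRingEnd ℂ p * p) / (1 - starRingEnd ℂ p * z) ^ 2))
    (fun z hz => ?_) hl.injOn ?_ (fun z hz => ?_) F
  · refine ((hasDerivAt_diskInvolution hp hz).const_mul c).congr_of_eventuallyEq ?_
    filter_upwards [isOpen_disk.mem_nhds hz] with w hw using hφc w hw
  · exact (hφm.image_subset).antisymm fun z hz => ⟨ψ z, hψm hz, hr hz⟩
  -- The unimodular constant drops out, and the identity becomes (Q(1 - |z|²))^s Q² = (1 - |z|²)^s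
  -- Q^(s+2).
  · have hq := one_sub_norm_sq_pos hp
    have hA := one_sub_norm_sq_pos hz
    have hD := norm_pos_iff.2 (one_sub_conj_mul_ne_zero hp hz)
    have e1 : 1 - ‖φ z‖ ^ 2 =
        (1 - ‖p‖ ^ 2) / ‖1 - starRingEnd ℂ p * z‖ ^ 2 * (1 - ‖z‖ ^ 2) := by
      rw [hφc z hz, norm_mul, hc, one_mul, one_sub_norm_diskInvolution_sq hp hz]
    have e2 : ‖1 - starRingEnd ℂ p * p‖ = 1 - ‖p‖ ^ 2 := by
      have : 1 - starRingEnd ℂ p * p = ((1 - ‖p‖ ^ 2 : ℝ) : ℂ) := by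
        rw [← Complex.normSq_eq_conj_mul_self, Complex.normSq_eq_norm_sq]
        push_cast
        rfl
      rw [this, Complex.norm_real, Real.norm_of_nonneg hq.le]
    rw [e1, norm_inv, inv_pow, norm_multiplierSymbol_sq s hp hz, inv_inv, norm_mul, hc, one_mul,
      norm_neg, norm_div, norm_pow, e2]
    have hQ : 0 < (1 - ‖p‖ ^ 2) / ‖1 - starRingEnd ℂ p * z‖ ^ 2 := by positivity
    generalize (1 - ‖p‖ ^ 2) / ‖1 - starRingEnd ℂ p * z‖ ^ 2 = Q at *
    rw [Real.mul_rpow hQ.le hA.le, Real.rpow_add hQ, Real.rpow_two]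
    ring

theorem IsDiskAutomorphism.eLpNorm_comp {s : ℝ} (hs : -1 < s) {φ : ℂ → ℂ}
    (hφ : IsDiskAutomorphism φ) {p : ℂ} (hp : p ∈ disk) (hφp : φ p = 0) (g : ℂ → ℂ) :
    eLpNorm (fun z => (multiplierSymbol s p z)⁻¹ * g (φ z)) 2 (weightedArea s) =
      eLpNorm g 2 (weightedArea s) := by
  rw [eLpNorm_two_eq, eLpNorm_two_eq, ← hφ.lintegral_comp hs hp hφp (fun z => ‖g z‖ₑ ^ 2)]
  simp only [enorm_mul, mul_pow]

/-- Composition with a disk automorphism, suitably weighted, is unitary on `A²_s(D)`. -/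
theorem IsDiskAutomorphism.exists_unitary {s : ℝ} (hs : -1 < s) {φ : ℂ → ℂ}
    (hφ : IsDiskAutomorphism φ) {p : ℂ} (hp : p ∈ disk) (hφp : φ p = 0) :
    ∃ U : bergmanSpace s →L[ℂ] bergmanSpace s, (∀ (f : bergmanSpace s) (g : ℂ → ℂ),
      IsHolomorphicRep (f : Lp ℂ 2 (weightedArea s)) g →
        IsHolomorphicRep (U f : Lp ℂ 2 (weightedArea s))
          (fun z => (multiplierSymbol s p z)⁻¹ * g (φ z))) ∧
      (∀ f, ‖U f‖ = ‖f‖) ∧ Function.Surjective U := by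
  have hsd := differentiableOn_multiplierSymbol s hp
  obtain ⟨U, hU⟩ := exists_weightedComposition hs hφ.1 hφ.2.1
    (hsd.inv fun z hz => multiplierSymbol_ne_zero s hp hz) 1
    (fun g _ => by rw [ENNReal.coe_one, one_mul]; exact (hφ.eLpNorm_comp hs hp hφp g).le)
  refine ⟨U, hU, fun f => ?_, fun f => ?_⟩
  · obtain ⟨g, hg⟩ := f.2
    have h1 := (hU f g hg).enorm_eq
    rw [Pi.inv_def, hφ.eLpNorm_comp hs hp hφp, ← hg.enorm_eq] at h1
    exact enorm_eq_iff_norm_eq.1 h1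
  · obtain ⟨g, hg⟩ := f.2
    obtain ⟨hφd, hφm, ψ, hψd, hψm, hl, hr⟩ := id hφ
    -- The solution of h⁻¹ · (G ∘ φ) = g. Its square integrability follows from the norm identity
    -- read backwards.
    set G : ℂ → ℂ := fun z => multiplierSymbol s p (ψ z) * g (ψ z) with hG
    have hGd : DifferentiableOn ℂ G disk := (hsd.comp hψd hψm).mul (hg.1.comp hψd hψm)
    have hGg : Set.EqOn (fun z => (multiplierSymbol s p z)⁻¹ * G (φ z)) g disk := by
      intro z hz
      simp only [hG]
      rw [hl hz, inv_mul_cancel_left₀ (multiplierSymbol_ne_zero s hp hz)]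
    have hGL : MemLp G 2 (weightedArea s) := by
      refine ⟨aestronglyMeasurable_of_differentiableOn s hGd, ?_⟩
      rw [← hφ.eLpNorm_comp hs hp hφp, eLpNorm_congr_ae (g := g)]
      · exact hg.memLp.2
      · filter_upwards [ae_mem_disk s] with z hz using hGg hz
    obtain ⟨F, hF⟩ := exists_isHolomorphicRep hGd hGL
    exact ⟨F, ext_of_isHolomorphicRep (hU F G hF) hg hGg⟩

/-- Multiplication by a bounded holomorphic function is a bounded operator on `A²_s(D)`. -/
theorem exists_multiplication {s : ℝ} (hs : -1 < s) {h : ℂ → ℂ} (hd : DifferentiableOn ℂ h disk)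
    {K : NNReal} (hK : ∀ z ∈ disk, ‖h z‖ₑ ≤ K) :
    ∃ M : bergmanSpace s →L[ℂ] bergmanSpace s, ∀ (f : bergmanSpace s) (g : ℂ → ℂ),
      IsHolomorphicRep (f : Lp ℂ 2 (weightedArea s)) g →
        IsHolomorphicRep (M f : Lp ℂ 2 (weightedArea s)) (fun z => h z * g z) := by
  refine exists_weightedComposition hs (φ := id) differentiableOn_id (Set.mapsTo_id _) hd K
    fun g _ => ?_
  refine eLpNorm_le_nnreal_smul_eLpNorm_of_ae_le_mul ?_ 2
  filter_upwards [ae_mem_disk s] with z hz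
  have := hK z hz
  rw [enorm_eq_nnnorm, ENNReal.coe_le_coe] at this
  rw [nnnorm_mul]
  gcongr
  rfl

/-- An isometry satisfies U*U = 1, so U* is isometric on the range of U, which is everything. -/
theorem norm_adjoint_of_surjective_isometry {E : Type*} [NormedAddCommGroup E]
    [InnerProductSpace ℂ E] [CompleteSpace E] {U : E →L[ℂ] E} (hU : ∀ x, ‖U x‖ = ‖x‖)
    (hsurj : Function.Surjective U) (x : E) : ‖ContinuousLinearMap.adjoint U x‖ = ‖x‖ := by
  obtain ⟨y, rfl⟩ := hsurj x
  have h := (ContinuousLinearMap.norm_map_iff_adjoint_comp_self U).1 hU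
  have h1 : ContinuousLinearMap.adjoint U (U y) = y := DFunLike.congr_fun h y
  rw [h1, hU]

end WeightedBergman

/-! ### The limit formula -/

theorem proposition2p3 (s : ℝ) (hs : -1 < s) (φ : ℂ → ℂ)
    (hφ : WeightedBergman.IsDiskAutomorphism φ)
    (p : ℂ) (hp : p ∈ WeightedBergman.disk) (hφp : φ p = 0) :
    ∃ C : WeightedBergman.bergmanSpace s →L[ℂ] WeightedBergman.bergmanSpace s,
      WeightedBergman.IsCompositionOperator C φ ∧
      Summable (fun k : ℕ => Ring.choose (s + 2) k ^ 2 * ‖p‖ ^ (2 * k)) ∧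
      Tendsto
        (fun n : ℕ => ‖ContinuousLinearMap.adjoint C (WeightedBergman.normalizedMonomial s n)‖ ^ 2)
        atTop
        (𝓝 (1 / (1 - ‖p‖ ^ 2) ^ (s + 2) *
          ∑' k : ℕ, Ring.choose (s + 2) k ^ 2 * ‖p‖ ^ (2 * k))) := by
  open WeightedBergman in
  have hsum := summable_choose_sq_mul_pow (s + 2) (norm_nonneg p) (mem_disk.1 hp)
  obtain ⟨U, hU, hUn, hUs⟩ := hφ.exists_unitary hs hp hφp
  obtain ⟨K, hK⟩ := exists_norm_multiplierSymbol_le hs hp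
  obtain ⟨M, hM⟩ := exists_multiplication hs (differentiableOn_multiplierSymbol s hp) hK
  -- The factor h of M cancels the h⁻¹ of U, leaving composition with φ.
  refine ⟨M ∘L U, fun f g hg => ?_, hsum, ?_⟩
  · refine (hM _ _ (hU f g hg)).congr fun z hz => ?_
    exact mul_inv_cancel_left₀ (multiplierSymbol_ne_zero s hp hz) _
  · have hcoeff := hasTaylorCoeff_multiplierSymbol s hp
    have hq := one_sub_norm_sq_pos hp
    have hb : ∀ k : ℕ, ‖(((1 - ‖p‖ ^ 2) ^ (-((s + 2) / 2)) : ℝ) : ℂ) *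
        (Ring.choose (s + 2) k : ℝ) * (-starRingEnd ℂ p) ^ k‖ ^ 2 =
        1 / (1 - ‖p‖ ^ 2) ^ (s + 2) * (Ring.choose (s + 2) k ^ 2 * ‖p‖ ^ (2 * k)) := by
      intro k
      have h1 : ((1 - ‖p‖ ^ 2) ^ (-((s + 2) / 2))) ^ 2 = 1 / (1 - ‖p‖ ^ 2) ^ (s + 2) := by
        rw [← Real.rpow_mul_natCast hq.le, one_div, ← Real.rpow_neg hq.le]
        congr 1
        push_cast
        ring
      rw [norm_mul, norm_mul, Complex.norm_real, Complex.norm_real, norm_pow, norm_neg,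
        RCLike.norm_conj, mul_pow, mul_pow, Real.norm_eq_abs, Real.norm_eq_abs, sq_abs, sq_abs, h1]
      ring
    have hlim := tendsto_sum_mul_monomialWeight_div hs (fun k => sq_nonneg _)
      ((hsum.mul_left (1 / (1 - ‖p‖ ^ 2) ^ (s + 2))).congr fun k => (hb k).symm)
    rw [tsum_congr hb, tsum_mul_left] at hlim
    refine hlim.congr fun n => ?_
    -- In the adjoint of M U the isometry U* acts last, so it does not affect the norm.
    rw [ContinuousLinearMap.adjoint_comp, ContinuousLinearMap.comp_apply,
      norm_adjoint_of_surjective_isometry hUn hUs,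
      norm_adjoint_mul_normalizedMonomial_sq hs hcoeff hM]
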